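/- A pairwise balanced design PBD$(v,K)$ is a pair $(X,\mathcal{B})$ where $X$ is a set of $v$ points and $\mathcal{B}$ is a family of subsets of $X$ (blocks), each of size in $K$, such that any two distinct points lie together in exactly one block. A flat is a set $Y\subseteq X$ such that any two distinct points of $Y$ lie together in a unique block among the blocks contained in $Y$; the flat generated by $S\subseteq X$ is the intersection of all flats containing $S$. Write $[e]_4 = 1+4+\dots+4^e$. **Theorem.** For every positive integer $v\notin\{2,6,8\}$ there exists a PBD$(v,\{3,4,5\})$ in which any three points generate a flat of size at most $63$, unless $v-[e]_4\in\{1,3,9\}$ for some integer $e\ge 3$, in which case there exists a PBD$(v,\{3,4,5\})$ in which any three points generate a flat of size at most $94$. -/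

import Mathlib

/-- A pairwise balanced design on the point set `X` with block sizes in `K`: a family of subsets of
`X` (the blocks) with sizes in `K` such that any two different points lie together in exactly one
block. It is a PBD(v, K) when `X` has `v` points. -/
structure PBD (X : Type*) (K : Set ℕ) where
  blocks : Set (Finset X)
  card_mem : ∀ B ∈ blocks, B.card ∈ K
  existsUnique_block : ∀ x y : X, x ≠ y → ∃! B : Finset X, B ∈ blocks ∧ x ∈ B ∧ y ∈ B

namespace PBD

variable {X : Type*} {K : Set ℕ}

/-- The blocks contained in the set of points `Y`. -/
def blocksIn (D : PBD X K) (Y : Set X) : Set (Finset X) :=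
  {B | B ∈ D.blocks ∧ (B : Set X) ⊆ Y}

/-- `Y` is (the point set of) a flat: any two distinct points of `Y` are together in a unique block
among the blocks contained in `Y`. -/
def IsFlat (D : PBD X K) (Y : Set X) : Prop :=
  ∀ x ∈ Y, ∀ y ∈ Y, x ≠ y → ∃! B : Finset X, B ∈ D.blocksIn Y ∧ x ∈ B ∧ y ∈ B

/-- The flat generated by `S`: the intersection of all flats that contain `S`. -/
def flatSpan (D : PBD X K) (S : Set X) : Set X :=
  ⋂₀ {Y | D.IsFlat Y ∧ S ⊆ Y}

theorem subset_flatSpan (D : PBD X K) (S : Set X) : S ⊆ D.flatSpan S :=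
  Set.subset_sInter fun _ hY => hY.2

theorem isFlat_flatSpan (D : PBD X K) (S : Set X) : D.IsFlat (D.flatSpan S) := by
  intro x hx y hy hxy
  obtain ⟨B, ⟨hB, hxB, hyB⟩, huniq⟩ := D.existsUnique_block x y hxy
  refine ⟨B, ⟨⟨hB, ?_⟩, hxB, hyB⟩, fun C hC => huniq C ⟨hC.1.1, hC.2⟩⟩
  refine Set.subset_sInter fun Y hY => ?_
  obtain ⟨C, ⟨hC, hCxy⟩, -⟩ := hY.1 x (hx Y hY) y (hy Y hY) hxy
  rw [← huniq C ⟨hC.1, hCxy⟩]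
  exact hC.2

end PBD

/-- `[d]_q = 1 + q + ⋯ + q ^ d`, the number of points of the projective space PG_d(q). -/
def projCount (q d : ℕ) : ℕ := ∑ i ∈ Finset.range (d + 1), q ^ i

/-! The construction is Wilson's: points of the projective space PG_d(4) get weights 0, 1 or 3, each
point is replaced by that many copies, and a small design is put above every five-point line, with
the copies of a point of weight three as a block. The union of these designs is a PBD
(`exists_pbd_of_weights`). Subspaces lift to flats, and three points lie above a plane, which has 21
points and so weight at most 63.

Write [d] for `projCount 4 d`. For v ≥ 4 there is a d with [d] - 1 ≤ v < 4[d], and the weights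
depend on where v lies in this range. Odd v up to 3[d]: weights 1 and 3 on all of PG_d(4)
(`hasPBD_of_odd`). Values v ≥ 3[d] - 1 other than 3[d]: points are deleted from PG_{d+1}(4).
Deleting exactly three points of a line would leave a block of size two, so the deleted set, chosen
affine, must have no three-secant (`hasNoThreeSecant_of_le_projCount`, `hasPBD_of_noThreeSecant`).
Remaining even v: one point is deleted from PG_d(4), and weights are chosen line by line through it
(`hasPBD_of_deleted_point`). The arithmetic fails exactly for v - [d] in {1, 3, 9}. For these values
one plane through the deleted point carries a single design found by computer (`hasPBD_of_plane`). A
flat may then have to contain this plane together with a second one, hence lie above a solid of 85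
points, which gives the bound 84 + 10 = 94. For d = 2 the whole design has at most 30 points, so 63
still holds. -/

/-! ### Weighted points and Wilson's fundamental construction. -/

/-- A family of blocks inside `s`, with sizes in `{3, 4, 5}`, that covers every pair of distinct
points of `s` exactly once. -/
structure IsDesignOn {Y : Type*} (s : Finset Y) (𝓑 : Set (Finset Y)) : Prop where
  subset : ∀ B ∈ 𝓑, B ⊆ s
  card_mem : ∀ B ∈ 𝓑, B.card ∈ ({3, 4, 5} : Set ℕ)
  existsUnique : ∀ x ∈ s, ∀ y ∈ s, x ≠ y → ∃! B, B ∈ 𝓑 ∧ x ∈ B ∧ y ∈ B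

/-- The points above `s` when every point `p` is replaced by `w p` copies of it. -/
def weightedPoints {P : Type*} (w : P → ℕ) (s : Finset P) : Finset (Σ _ : P, ℕ) :=
  s.sigma fun p => Finset.range (w p)

theorem mem_weightedPoints {P : Type*} {w : P → ℕ} {s : Finset P} {x : Σ _ : P, ℕ} :
    x ∈ weightedPoints w s ↔ x.1 ∈ s ∧ x.2 < w x.1 := by
  simp [weightedPoints]

theorem card_weightedPoints {P : Type*} (w : P → ℕ) (s : Finset P) :
    (weightedPoints w s).card = ∑ p ∈ s, w p := by
  simp [weightedPoints]

theorem weightedPoints_mono {P : Type*} (w : P → ℕ) {s t : Finset P} (h : s ⊆ t) :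
    weightedPoints w s ⊆ weightedPoints w t := fun _ hx =>
  mem_weightedPoints.2 ⟨h (mem_weightedPoints.1 hx).1, (mem_weightedPoints.1 hx).2⟩

/-- There is a design on the points above `s` in which the copies of any point of weight at least
two form a block. -/
def HasWeightedDesign {P : Type*} (w : P → ℕ) (s : Finset P) : Prop :=
  ∃ 𝓑, IsDesignOn (weightedPoints w s) 𝓑 ∧ ∀ p ∈ s, 2 ≤ w p → weightedPoints w {p} ∈ 𝓑

/-- A design on a finite set in which any three points lie in a small closed subset gives a PBD in
which three points generate a small flat. -/
theorem IsDesignOn.exists_pbd {Y : Type} {s : Finset Y} {𝓑 : Set (Finset Y)}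
    (h : IsDesignOn s 𝓑) (m : ℕ)
    (hflat : ∀ S ⊆ s, S.card = 3 → ∃ T ⊆ s, S ⊆ T ∧ T.card ≤ m ∧
      ∀ B ∈ 𝓑, ∀ a ∈ T, ∀ b ∈ T, a ≠ b → a ∈ B → b ∈ B → B ⊆ T) :
    ∃ (X : Type) (_ : Fintype X) (D : PBD X {3, 4, 5}), Fintype.card X = s.card ∧
      ∀ S : Finset X, S.card = 3 → (D.flatSpan (S : Set X)).ncard ≤ m := by
  classical
  let emb : s ↪ Y := Function.Embedding.subtype _
  have key : ∀ x y : s, x ≠ y → ∃! B : Finset s, B ∈ {B : Finset s | B.map emb ∈ 𝓑} ∧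
      x ∈ B ∧ y ∈ B := by
    intro x y hxy
    obtain ⟨B, ⟨hB, hx, hy⟩, hu⟩ :=
      h.existsUnique x x.2 y y.2 fun e => hxy (Subtype.ext e)
    have hBm : (B.subtype (· ∈ s)).map emb = B :=
      Finset.subtype_map_of_mem fun z hz => h.subset B hB hz
    refine ⟨B.subtype (· ∈ s), ⟨?_, by simpa using hx, by simpa using hy⟩, ?_⟩
    · rw [Set.mem_ofPred_eq, hBm]; exact hB
    · rintro C ⟨hC, hxC, hyC⟩
      apply Finset.map_injective emb
      rw [hBm]
      exact hu _ ⟨hC, Finset.mem_map_of_mem emb hxC, Finset.mem_map_of_mem emb hyC⟩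
  have hcard : ∀ B ∈ {B : Finset s | B.map emb ∈ 𝓑}, B.card ∈ ({3, 4, 5} : Set ℕ) := by
    intro B hB
    rw [← Finset.card_map emb]
    exact h.card_mem _ hB
  refine ⟨s, inferInstance, ⟨{B | B.map emb ∈ 𝓑}, hcard, key⟩, by simp, ?_⟩
  · intro S hS
    obtain ⟨T, hTs, hST, hTm, hT⟩ := hflat (S.map emb)
      (fun y hy => by obtain ⟨z, -, rfl⟩ := Finset.mem_map.1 hy; exact z.2) (by simpa using hS)
    have hsub : PBD.flatSpan ⟨{B | B.map emb ∈ 𝓑}, hcard, key⟩ (S : Set s) ⊆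
        (T.subtype (· ∈ s) : Finset s) := by
      apply Set.sInter_subset_of_mem
      refine ⟨?_, ?_⟩
      · intro x hx y hy hxy
        obtain ⟨B, ⟨hB, hxB, hyB⟩, hu⟩ := key x y hxy
        refine ⟨B, ⟨⟨hB, ?_⟩, hxB, hyB⟩, fun C hC => hu C ⟨hC.1.1, hC.2⟩⟩
        intro z hz
        have := hT _ hB x (by simpa using hx) y (by simpa using hy)
          (fun e => hxy (Subtype.ext e)) (Finset.mem_map_of_mem emb hxB)
          (Finset.mem_map_of_mem emb hyB) (Finset.mem_map_of_mem emb hz)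
        exact Finset.mem_coe.2 (Finset.mem_subtype.2 this)
      · intro x hx
        have := hST (Finset.mem_map_of_mem emb hx)
        exact Finset.mem_coe.2 (Finset.mem_subtype.2 this)
    refine (Set.ncard_le_ncard hsub (Finset.finite_toSet _)).trans ?_
    rw [Set.ncard_coe_finset, Finset.card_subtype]
    exact (Finset.card_filter_le _ _).trans hTm

/-- Wilson's fundamental construction: designs above the lines of a linear space are joined to a
design above the whole space; flats of the linear space lift to flats. -/
theorem exists_pbd_of_weights {P : Type} [Fintype P] [DecidableEq P] (w : P → ℕ)
    (𝓛 : Set (Finset P))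
    (hex : ∀ p q, p ≠ q → ∃ l ∈ 𝓛, p ∈ l ∧ q ∈ l)
    (huniq : ∀ p q, p ≠ q → ∀ l ∈ 𝓛, ∀ l' ∈ 𝓛, p ∈ l → q ∈ l → p ∈ l' → q ∈ l' → l = l')
    (hpt : ∀ p, ∃ l ∈ 𝓛, p ∈ l)
    (hdes : ∀ l ∈ 𝓛, HasWeightedDesign w l) (m : ℕ)
    (hflat : ∀ p q r, ∃ T : Finset P, p ∈ T ∧ q ∈ T ∧ r ∈ T ∧ ∑ x ∈ T, w x ≤ m ∧
      ∀ l ∈ 𝓛, ∀ a ∈ T, ∀ b ∈ T, a ≠ b → a ∈ l → b ∈ l → l ⊆ T) :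
    ∃ (X : Type) (_ : Fintype X) (D : PBD X {3, 4, 5}), Fintype.card X = ∑ p, w p ∧
      ∀ S : Finset X, S.card = 3 → (D.flatSpan (S : Set X)).ncard ≤ m := by
  classical
  choose! 𝓑 h𝓑 hgrp using hdes
  -- Two copies of one point lie together only in the block of all its copies. This block is shared
  -- by the designs above all lines through the point, so it causes no double covering in the union.
  have hsame : ∀ l ∈ 𝓛, ∀ B ∈ 𝓑 l, ∀ x ∈ B, ∀ y ∈ B, x ≠ y → x.1 = y.1 →
      B = weightedPoints w {x.1} := by
    intro l hl B hB x hx y hy hxy he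
    have hx' := mem_weightedPoints.1 ((h𝓑 l hl).subset B hB hx)
    have hy' := mem_weightedPoints.1 ((h𝓑 l hl).subset B hB hy)
    have h2 : 2 ≤ w x.1 := by
      by_contra hlt
      have h1 := hx'.2
      have h2 := hy'.2
      rw [← he] at h2
      apply hxy
      obtain ⟨x1, x2⟩ := x
      obtain ⟨y1, y2⟩ := y
      simp only at he h1 h2 hlt
      subst he
      have : x2 = y2 := by omega
      rw [this]
    refine ((h𝓑 l hl).existsUnique x (mem_weightedPoints.2 hx') y (mem_weightedPoints.2 hy')
      hxy).unique ⟨hB, hx, hy⟩ ⟨hgrp l hl _ hx'.1 h2, ?_, ?_⟩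
    · exact mem_weightedPoints.2 ⟨by simp, hx'.2⟩
    · exact mem_weightedPoints.2 ⟨by simp [he], hy'.2⟩
  have hmain : IsDesignOn (weightedPoints w Finset.univ) (⋃ l ∈ 𝓛, 𝓑 l) := by
    refine ⟨?_, ?_, ?_⟩
    · intro B hB
      simp only [Set.mem_iUnion] at hB
      obtain ⟨l, hl, hB⟩ := hB
      exact ((h𝓑 l hl).subset B hB).trans (weightedPoints_mono w (Finset.subset_univ _))
    · intro B hB
      simp only [Set.mem_iUnion] at hB
      obtain ⟨l, hl, hB⟩ := hB
      exact (h𝓑 l hl).card_mem B hB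
    · intro x hx y hy hxy
      have hx2 := (mem_weightedPoints.1 hx).2
      have hy2 := (mem_weightedPoints.1 hy).2
      obtain ⟨l, hl, hxl, hyl⟩ : ∃ l ∈ 𝓛, x.1 ∈ l ∧ y.1 ∈ l := by
        by_cases he : x.1 = y.1
        · obtain ⟨l, hl, h⟩ := hpt x.1
          exact ⟨l, hl, h, he ▸ h⟩
        · exact hex _ _ he
      obtain ⟨B, ⟨hB, hxB, hyB⟩, hu⟩ := (h𝓑 l hl).existsUnique x
        (mem_weightedPoints.2 ⟨hxl, hx2⟩) y (mem_weightedPoints.2 ⟨hyl, hy2⟩) hxy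
      refine ⟨B, ⟨Set.mem_biUnion hl hB, hxB, hyB⟩, ?_⟩
      rintro C ⟨hC, hxC, hyC⟩
      simp only [Set.mem_iUnion] at hC
      obtain ⟨l', hl', hC⟩ := hC
      by_cases he : x.1 = y.1
      · rw [hsame l hl B hB x hxB y hyB hxy he, hsame l' hl' C hC x hxC y hyC hxy he]
      · have hxl' := (mem_weightedPoints.1 ((h𝓑 l' hl').subset C hC hxC)).1
        have hyl' := (mem_weightedPoints.1 ((h𝓑 l' hl').subset C hC hyC)).1
        obtain rfl := huniq _ _ he l hl l' hl' hxl hyl hxl' hyl'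
        exact hu C ⟨hC, hxC, hyC⟩
  have := hmain.exists_pbd m ?_
  · rwa [card_weightedPoints] at this
  · intro S hS hS3
    obtain ⟨x, y, z, -, -, -, rfl⟩ := Finset.card_eq_three.1 hS3
    obtain ⟨T, hxT, hyT, hzT, hTm, hT⟩ := hflat x.1 y.1 z.1
    refine ⟨weightedPoints w T, weightedPoints_mono w (Finset.subset_univ _), ?_,
      (card_weightedPoints w T).trans_le hTm, ?_⟩
    · intro a ha
      refine mem_weightedPoints.2 ⟨?_, (mem_weightedPoints.1 (hS ha)).2⟩
      simp only [Finset.mem_insert, Finset.mem_singleton] at ha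
      rcases ha with rfl | rfl | rfl <;> assumption
    · intro B hB a ha b hb hab haB hbB
      simp only [Set.mem_iUnion] at hB
      obtain ⟨l, hl, hB⟩ := hB
      have haT := (mem_weightedPoints.1 ha).1
      by_cases he : a.1 = b.1
      · rw [hsame l hl B hB a haB b hbB hab he]
        exact weightedPoints_mono w (by simpa using haT)
      · refine ((h𝓑 l hl).subset B hB).trans (weightedPoints_mono w ?_)
        exact hT l hl _ haT _ (mem_weightedPoints.1 hb).1 he
          (mem_weightedPoints.1 ((h𝓑 l hl).subset B hB haB)).1
          (mem_weightedPoints.1 ((h𝓑 l hl).subset B hB hbB)).1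

/-! ### Explicit designs checked by computation. -/

/-- The number `c` is the code of copy `c % 3` of the point with index `c / 3`. -/
def isCode (L : List ℕ) (c : ℕ) : Bool := decide (c % 3 < L.getD (c / 3) 0)

def codes (L : List ℕ) : List ℕ := (List.range (3 * L.length)).filter (isCode L)

/-- `bs` lists the blocks, given by codes, of a design above points with weights `L` (equal to
`0`, `1` or `3`), in which the copies of a point of weight three form a block. -/
def certifies (L : List ℕ) (bs : List (List ℕ)) : Bool :=
  bs.all (fun b => (b.length == 3 || b.length == 4 || b.length == 5) && decide b.Nodup &&
    b.all (isCode L)) &&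
  (codes L).all (fun x => (codes L).all fun y =>
    x == y || ((bs.filter fun b => b.contains x).filter fun b => b.contains y).length == 1) &&
  (List.range L.length).all (fun i => decide (L.getD i 0 ≤ 1) ||
    (L.getD i 0 == 3 && bs.contains [3 * i, 3 * i + 1, 3 * i + 2]))

theorem hasWeightedDesign_of_certifies {P : Type*} [DecidableEq P] {w : P → ℕ} {L : List ℕ}
    {bs : List (List ℕ)} (h : certifies L bs = true) {s : Finset P} (e : ℕ → P)
    (he : Set.InjOn e {i | i < L.length}) (hs : (Finset.range L.length).image e = s)
    (hw : ∀ i < L.length, w (e i) = L.getD i 0) : HasWeightedDesign w s := by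
  simp only [certifies, Bool.and_eq_true, List.all_eq_true, Bool.or_eq_true, beq_iff_eq,
    decide_eq_true_eq, List.mem_range, List.contains_iff_mem] at h
  obtain ⟨⟨hb, hpair⟩, hg⟩ := h
  let φ : ℕ → Σ _ : P, ℕ := fun c => ⟨e (c / 3), c % 3⟩
  -- Indices beyond the end of `L` get the default weight 0, so they have no codes.
  have hlt : ∀ c, isCode L c = true → c / 3 < L.length := by
    intro c hc
    by_contra hn
    rw [isCode, List.getD_eq_default _ _ (not_lt.1 hn)] at hc
    simp at hc
  have hφ : ∀ c c', isCode L c = true → isCode L c' = true → φ c = φ c' → c = c' := by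
    intro c c' hc hc' hcc
    simp only [φ, Sigma.mk.injEq, heq_eq_eq] at hcc
    have := he (hlt c hc) (hlt c' hc') hcc.1
    omega
  have hcode : ∀ c, isCode L c = true → c ∈ codes L := by
    intro c hc
    have := hlt c hc
    exact List.mem_filter.2 ⟨List.mem_range.2 (by omega), hc⟩
  have hφmem : ∀ c, isCode L c = true → φ c ∈ weightedPoints w s := by
    intro c hc
    refine mem_weightedPoints.2 ⟨?_, ?_⟩
    · rw [← hs]
      exact Finset.mem_image_of_mem e (Finset.mem_range.2 (hlt c hc))
    · simp only [φ]
      rw [hw _ (hlt c hc)]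
      simpa [isCode] using hc
  have hle3 : ∀ i < L.length, L.getD i 0 ≤ 3 := by
    intro i hi
    rcases hg i hi with h | h <;> omega
  have hφsurj : ∀ x ∈ weightedPoints w s, ∃ c, isCode L c = true ∧ φ c = x := by
    rintro ⟨p, j⟩ hx
    obtain ⟨hp, hj⟩ := mem_weightedPoints.1 hx
    rw [← hs] at hp
    obtain ⟨i, hi, rfl⟩ := Finset.mem_image.1 hp
    have hi' := Finset.mem_range.1 hi
    simp only [hw i hi'] at hj
    have h3 := hle3 i hi'
    have h1 : (3 * i + j) / 3 = i := by omega
    have h2 : (3 * i + j) % 3 = j := by omega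
    exact ⟨3 * i + j, by simp only [isCode, h1, h2, decide_eq_true_eq]; exact hj,
      by simp only [φ, h1, h2]⟩
  have hmemB : ∀ b ∈ bs, ∀ c, isCode L c = true → (φ c ∈ b.toFinset.image φ ↔ c ∈ b) := by
    intro b hbb c hc
    constructor
    · intro h
      obtain ⟨c', hc', hcc⟩ := Finset.mem_image.1 h
      rw [List.mem_toFinset] at hc'
      rwa [← hφ c' c ((hb b hbb).2 c' hc') hc hcc]
    · exact fun h => Finset.mem_image_of_mem φ (List.mem_toFinset.2 h)
  refine ⟨{B | ∃ b ∈ bs, b.toFinset.image φ = B}, ⟨?_, ?_, ?_⟩, ?_⟩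
  · rintro _ ⟨b, hbb, rfl⟩ x hx
    obtain ⟨c, hc, rfl⟩ := Finset.mem_image.1 hx
    exact hφmem c ((hb b hbb).2 c (List.mem_toFinset.1 hc))
  · rintro _ ⟨b, hbb, rfl⟩
    rw [Finset.card_image_of_injOn, List.toFinset_card_of_nodup (hb b hbb).1.2]
    · have := (hb b hbb).1.1
      simp only [Set.mem_insert_iff, Set.mem_singleton_iff]
      tauto
    · intro c hc c' hc' hcc
      exact hφ c c' ((hb b hbb).2 c (List.mem_toFinset.1 hc))
        ((hb b hbb).2 c' (List.mem_toFinset.1 hc')) hcc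
  · intro x hx y hy hxy
    obtain ⟨c, hc, rfl⟩ := hφsurj x hx
    obtain ⟨c', hc', rfl⟩ := hφsurj y hy
    have hcc : c ≠ c' := fun h => hxy (by rw [h])
    have hp := (hpair c (hcode c hc) c' (hcode c' hc')).resolve_left hcc
    obtain ⟨b, hbe⟩ := List.length_eq_one_iff.1 hp
    have hmem : ∀ b', (b' ∈ bs ∧ c ∈ b' ∧ c' ∈ b') ↔ b' = b := by
      intro b'
      have : b' ∈ List.filter (fun b => b.contains c') (List.filter (fun b => b.contains c) bs) ↔
          b' ∈ [b] := by rw [hbe]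
      simpa [List.mem_filter, and_assoc, and_comm (a := c' ∈ b')] using this
    obtain ⟨hbb, h1, h2⟩ := (hmem b).2 rfl
    refine ⟨b.toFinset.image φ, ⟨⟨b, hbb, rfl⟩, (hmemB b hbb c hc).2 h1,
      (hmemB b hbb c' hc').2 h2⟩, ?_⟩
    rintro _ ⟨⟨b', hbb', rfl⟩, h1', h2'⟩
    rw [(hmem b').1 ⟨hbb', (hmemB b' hbb' c hc).1 h1', (hmemB b' hbb' c' hc').1 h2'⟩]
  · intro p hp hp2
    rw [← hs] at hp
    obtain ⟨i, hi, rfl⟩ := Finset.mem_image.1 hp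
    have hi' := Finset.mem_range.1 hi
    rw [hw i hi'] at hp2
    obtain ⟨h3, hmem⟩ := (hg i hi').resolve_left (by omega)
    refine ⟨_, hmem, ?_⟩
    have h0 : (3 * i) / 3 = i := by omega
    have h1 : (3 * i + 1) / 3 = i := by omega
    have h2 : (3 * i + 2) / 3 = i := by omega
    have h0' : (3 * i) % 3 = 0 := by omega
    have h1' : (3 * i + 1) % 3 = 1 := by omega
    have h2' : (3 * i + 2) % 3 = 2 := by omega
    ext ⟨q, j⟩
    simp only [List.toFinset_cons, List.toFinset_nil, Finset.mem_image, Finset.mem_insert,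
      exists_eq_or_imp, φ, h0, h1, h2, h0', h1', h2', mem_weightedPoints, Finset.mem_singleton, insert_empty_eq, exists_eq_left,
      Sigma.mk.injEq, heq_eq_eq]
    constructor
    · rintro (⟨rfl, rfl⟩ | ⟨rfl, rfl⟩ | ⟨rfl, rfl⟩) <;> simp only [hw i hi', h3] <;> simp
    · rintro ⟨rfl, hj⟩
      rw [hw i hi', h3] at hj
      interval_cases j <;> simp

/-- Only the multiset of the weights of the points matters. -/
theorem hasWeightedDesign_of_map_eq {P : Type*} {w : P → ℕ} {L : List ℕ}
    {bs : List (List ℕ)} (h : certifies L bs = true) {s : Finset P}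
    (hs : s.val.map w = (L : Multiset ℕ)) : HasWeightedDesign w s := by
  classical
  obtain ⟨l₀, hl₀⟩ : ∃ l₀ : List P, (l₀ : Multiset P) = s.val := ⟨_, Multiset.coe_toList _⟩
  rw [← hl₀, Multiset.map_coe, Multiset.coe_eq_coe] at hs
  obtain ⟨l, hl, hlp⟩ : ∃ l : List P, l.map w = L ∧ l.Perm l₀ := by
    -- A permutation of the list of weights is lifted to a permutation of the list of points.
    have : Relation.Comp List.Perm (List.Forall₂ fun a b => w a = b) l₀ L := by
      rw [← List.forall₂_comp_perm_eq_perm_comp_forall₂]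
      refine ⟨l₀.map w, ?_, hs⟩
      rw [List.forall₂_map_right_iff]
      exact List.forall₂_same.2 fun _ _ => rfl
    obtain ⟨l, h1, h2⟩ := this
    refine ⟨l, ?_, h1.symm⟩
    rw [← List.forall₂_eq_eq_eq, List.forall₂_map_left_iff]
    exact h2
  have hval : s.val = (l : Multiset P) := by rw [← hl₀]; exact (Multiset.coe_eq_coe.2 hlp).symm
  have hnd : l.Nodup := by
    have := s.nodup
    rwa [hval, Multiset.coe_nodup] at this
  have hlen : L.length = l.length := by rw [← hl, List.length_map]
  -- The enumeration by `getD` needs some point as default value, so the empty list is treated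
  -- separately.
  rcases l with _ | ⟨a, l'⟩
  · refine ⟨∅, ⟨by simp, by simp, ?_⟩, ?_⟩
    · intro x hx
      have := (mem_weightedPoints.1 hx).1
      rw [← Finset.mem_val, hval] at this
      simp at this
    · intro p hp
      rw [← Finset.mem_val, hval] at hp
      simp at hp
  · generalize hl2 : a :: l' = l at *
    refine hasWeightedDesign_of_certifies h (fun i => l.getD i a) ?_ ?_ ?_
    · intro i hi j hj hij
      simp only [Set.mem_ofPred_eq, hlen] at hi hj
      simp only [List.getD_eq_getElem _ _ hi, List.getD_eq_getElem _ _ hj] at hij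
      exact (List.Nodup.getElem_inj_iff hnd).1 hij
    · ext p
      rw [← Finset.mem_val (s := s), hval, Multiset.mem_coe, List.mem_iff_getElem]
      simp only [Finset.mem_image, Finset.mem_range, hlen]
      constructor
      · rintro ⟨i, hi, rfl⟩
        exact ⟨i, hi, (List.getD_eq_getElem _ _ hi).symm⟩
      · rintro ⟨i, hi, rfl⟩
        exact ⟨i, hi, List.getD_eq_getElem _ _ hi⟩
    · intro i hi
      have hi' := hi
      rw [hlen] at hi'
      simp only [List.getD_eq_getElem _ _ hi', List.getD_eq_getElem _ _ hi]
      simp [← hl]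

/-! ### Designs above lines and above a special plane. -/

/-- The weights that the five points of a line may have: a design above such a line exists. -/
def lineTypes : List (List ℕ) :=
  [[0, 0, 0, 0, 0],
   [1, 0, 0, 0, 0],
   [1, 1, 1, 0, 0],
   [1, 1, 1, 1, 0],
   [1, 1, 1, 1, 1],
   [3, 1, 1, 1, 1],
   [3, 3, 1, 1, 1],
   [3, 3, 3, 1, 1],
   [3, 3, 3, 3, 1],
   [3, 3, 3, 3, 3],
   [3, 3, 3, 1, 0],
   [3, 3, 3, 3, 0]]

/-- If all weights are 0 or 1, the surviving points form one block, or there are too few to need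
any. With weights 1 and 3 on all five points the design is a Steiner triple system on 7, 9, 13 or 15
points, or has one block of size five and triples on 11 points. The last type is a transversal
design with four groups of size three. -/
theorem hasWeightedDesign_of_mem_lineTypes {P : Type*} {w : P → ℕ} {s : Finset P} {L : List ℕ}
    (hL : L ∈ lineTypes) (hs : s.val.map w = (L : Multiset ℕ)) : HasWeightedDesign w s := by
  suffices h : ∃ bs, certifies L bs = true from
    h.elim fun bs hbs => hasWeightedDesign_of_map_eq hbs hs
  simp only [lineTypes, List.mem_cons, List.not_mem_nil, or_false] at hL
  rcases hL with rfl | rfl | rfl | rfl | rfl | rfl | rfl | rfl | rfl | rfl | rfl | rfl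
  · exact ⟨
      [],
      by decide +kernel⟩
  · exact ⟨
      [],
      by decide +kernel⟩
  · exact ⟨
      [[0, 3, 6]],
      by decide +kernel⟩
  · exact ⟨
      [[0, 3, 6, 9]],
      by decide +kernel⟩
  · exact ⟨
      [[0, 3, 6, 9, 12]],
      by decide +kernel⟩
  · exact ⟨
      [[0, 1, 2], [0, 3, 12], [0, 6, 9], [1, 3, 9], [1, 6, 12], [2, 3, 6], [2, 9, 12]],
      by decide +kernel⟩
  · exact ⟨
      [[0, 1, 2], [0, 3, 9], [0, 4, 6], [0, 5, 12], [1, 3, 6], [1, 4, 12], [1, 5, 9], [2, 3, 12],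
       [2, 4, 9], [2, 5, 6], [3, 4, 5], [6, 9, 12]],
      by decide +kernel⟩
  · exact ⟨
      [[0, 1, 2], [0, 3, 6, 9, 12], [0, 4, 8], [0, 5, 7], [1, 3, 7], [1, 4, 9], [1, 5, 6],
       [1, 8, 12], [2, 3, 8], [2, 4, 6], [2, 5, 12], [2, 7, 9], [3, 4, 5], [4, 7, 12], [5, 8, 9],
       [6, 7, 8]],
      by decide +kernel⟩
  · exact ⟨
      [[0, 1, 2], [0, 3, 6], [0, 4, 10], [0, 5, 8], [0, 7, 11], [0, 9, 12], [1, 3, 7],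
       [1, 4, 11], [1, 5, 12], [1, 6, 10], [1, 8, 9], [2, 3, 9], [2, 4, 6], [2, 5, 11],
       [2, 7, 12], [2, 8, 10], [3, 4, 5], [3, 8, 11], [3, 10, 12], [4, 7, 9], [4, 8, 12],
       [5, 6, 9], [5, 7, 10], [6, 7, 8], [6, 11, 12], [9, 10, 11]],
      by decide +kernel⟩
  · exact ⟨
      [[0, 1, 2], [0, 3, 9], [0, 4, 14], [0, 5, 13], [0, 6, 12], [0, 7, 11], [0, 8, 10],
       [1, 3, 6], [1, 4, 10], [1, 5, 7], [1, 8, 12], [1, 9, 13], [1, 11, 14], [2, 3, 10],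
       [2, 4, 12], [2, 5, 6], [2, 7, 14], [2, 8, 9], [2, 11, 13], [3, 4, 5], [3, 7, 13],
       [3, 8, 14], [3, 11, 12], [4, 6, 11], [4, 7, 9], [4, 8, 13], [5, 8, 11], [5, 9, 12],
       [5, 10, 14], [6, 7, 8], [6, 9, 14], [6, 10, 13], [7, 10, 12], [9, 10, 11], [12, 13, 14]],
      by decide +kernel⟩
  · exact ⟨
      [[0, 1, 2], [0, 3, 6, 9], [0, 4, 8], [0, 5, 7], [1, 3, 8], [1, 4, 7, 9], [1, 5, 6],
       [2, 3, 7], [2, 4, 6], [2, 5, 8, 9], [3, 4, 5], [6, 7, 8]],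
      by decide +kernel⟩
  · exact ⟨
      [[0, 1, 2], [0, 3, 6, 9], [0, 4, 7, 11], [0, 5, 8, 10], [1, 3, 7, 10], [1, 4, 8, 9],
       [1, 5, 6, 11], [2, 3, 8, 11], [2, 4, 6, 10], [2, 5, 7, 9], [3, 4, 5], [6, 7, 8],
       [9, 10, 11]],
      by decide +kernel⟩

/-- The weights of the points of a plane with one deleted point and 1 point of weight three. -/
theorem hasWeightedDesign_plane_22 {P : Type*} {w : P → ℕ} {s : Finset P}
    (hs : s.val.map w =
      ((List.replicate 1 3 ++ List.replicate 19 1 ++ [0] : List ℕ) : Multiset ℕ)) :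
    HasWeightedDesign w s :=
  hasWeightedDesign_of_map_eq (bs :=
    [[0, 1, 2], [0, 3, 6, 57], [0, 9, 48], [0, 12, 54], [0, 15, 51], [0, 18, 33], [0, 21, 36],
     [0, 24, 39], [0, 27, 42], [0, 30, 45], [1, 3, 33], [1, 6, 36], [1, 9, 39], [1, 12, 42],
     [1, 15, 45], [1, 18, 21, 57], [1, 24, 48], [1, 27, 54], [1, 30, 51], [2, 3, 30], [2, 6, 27],
     [2, 9, 24], [2, 12, 21], [2, 15, 18], [2, 33, 36, 57], [2, 39, 48], [2, 42, 54],
     [2, 45, 51], [3, 9, 54], [3, 12, 51], [3, 15, 48], [3, 18, 36], [3, 21, 39], [3, 24, 42],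
     [3, 27, 45], [6, 9, 51], [6, 12, 48], [6, 15, 54], [6, 18, 39], [6, 21, 42], [6, 24, 45],
     [6, 30, 33], [9, 12, 15, 57], [9, 18, 42], [9, 21, 45], [9, 27, 33], [9, 30, 36],
     [12, 18, 45], [12, 24, 33], [12, 27, 36], [12, 30, 39], [15, 21, 33], [15, 24, 36],
     [15, 27, 39], [15, 30, 42], [18, 24, 54], [18, 27, 51], [18, 30, 48], [21, 24, 51],
     [21, 27, 48], [21, 30, 54], [24, 27, 30, 57], [33, 39, 54], [33, 42, 51], [33, 45, 48],
     [36, 39, 51], [36, 42, 48], [36, 45, 54], [39, 42, 45, 57], [48, 51, 54, 57]])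
    (by decide +kernel) hs

/-- The weights of the points of a plane with one deleted point and 2 points of weight three. -/
theorem hasWeightedDesign_plane_24 {P : Type*} {w : P → ℕ} {s : Finset P}
    (hs : s.val.map w =
      ((List.replicate 2 3 ++ List.replicate 18 1 ++ [0] : List ℕ) : Multiset ℕ)) :
    HasWeightedDesign w s :=
  hasWeightedDesign_of_map_eq (bs :=
    [[0, 1, 2], [0, 3, 18, 51], [0, 4, 36], [0, 5, 21], [0, 6, 12], [0, 9, 57], [0, 15, 54],
     [0, 24, 39], [0, 27, 42], [0, 30, 45], [0, 33, 48], [1, 3, 36], [1, 4, 33, 51], [1, 5, 6],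
     [1, 9, 39], [1, 12, 42], [1, 15, 45], [1, 18, 48], [1, 21, 27], [1, 24, 57], [1, 30, 54],
     [2, 3, 33], [2, 4, 18], [2, 5, 42], [2, 6, 30], [2, 9, 27], [2, 12, 24], [2, 15, 21],
     [2, 36, 48, 51], [2, 39, 57], [2, 45, 54], [3, 4, 5], [3, 6, 57], [3, 9, 15], [3, 12, 54],
     [3, 21, 39], [3, 24, 42], [3, 27, 45], [3, 30, 48], [4, 6, 39], [4, 9, 42], [4, 12, 45],
     [4, 15, 48], [4, 21, 57], [4, 24, 30], [4, 27, 54], [5, 9, 33], [5, 12, 30], [5, 15, 27],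
     [5, 18, 24], [5, 36, 57], [5, 39, 48, 54], [5, 45, 51], [6, 9, 18, 54], [6, 15, 51],
     [6, 21, 42], [6, 24, 45], [6, 27, 48], [6, 33, 36], [9, 12, 51], [9, 21, 45], [9, 24, 48],
     [9, 30, 36], [12, 15, 18, 57], [12, 21, 48], [12, 27, 36], [12, 33, 39], [15, 24, 36],
     [15, 30, 39], [15, 33, 42], [18, 21, 36], [18, 27, 39], [18, 30, 42], [18, 33, 45],
     [21, 24, 33, 54], [21, 30, 51], [24, 27, 51], [27, 30, 33, 57], [36, 39, 45], [36, 42, 54],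
     [39, 42, 51], [42, 45, 48, 57], [51, 54, 57]])
    (by decide +kernel) hs

/-- The weights of the points of a plane with one deleted point and 5 points of weight three. -/
theorem hasWeightedDesign_plane_30 {P : Type*} {w : P → ℕ} {s : Finset P}
    (hs : s.val.map w =
      ((List.replicate 5 3 ++ List.replicate 15 1 ++ [0] : List ℕ) : Multiset ℕ)) :
    HasWeightedDesign w s :=
  hasWeightedDesign_of_map_eq (bs :=
    [[0, 1, 2], [0, 3, 6, 27], [0, 4, 45], [0, 5, 7], [0, 8, 13], [0, 9, 18], [0, 10, 48],
     [0, 11, 33], [0, 12, 24], [0, 14, 39], [0, 15, 21], [0, 30, 51], [0, 36, 54], [0, 42, 57],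
     [1, 3, 45], [1, 4, 7, 42], [1, 5, 6], [1, 8, 12], [1, 9, 48], [1, 10, 33], [1, 11, 18],
     [1, 13, 39], [1, 14, 24], [1, 15, 51], [1, 21, 54], [1, 27, 57], [1, 30, 36], [2, 3, 42],
     [2, 4, 27], [2, 5, 45, 57], [2, 6, 39], [2, 7, 24], [2, 8, 14], [2, 9, 36], [2, 10, 21],
     [2, 11, 48], [2, 12, 33], [2, 13, 18], [2, 15, 30], [2, 51, 54], [3, 4, 5], [3, 7, 48],
     [3, 8, 10], [3, 9, 24], [3, 11, 30], [3, 12, 21], [3, 13, 51], [3, 14, 36], [3, 15, 18],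
     [3, 33, 54], [3, 39, 57], [4, 6, 48], [4, 8, 9], [4, 10, 39], [4, 11, 15], [4, 12, 51],
     [4, 13, 36], [4, 14, 21], [4, 18, 54], [4, 24, 57], [4, 30, 33], [5, 8, 11], [5, 9, 42],
     [5, 10, 27], [5, 12, 39], [5, 13, 24], [5, 14, 51], [5, 15, 36], [5, 18, 33], [5, 21, 30],
     [5, 48, 54], [6, 7, 8], [6, 9, 21], [6, 10, 51], [6, 11, 13], [6, 12, 18], [6, 14, 33],
     [6, 15, 24], [6, 30, 54], [6, 36, 57], [6, 42, 45], [7, 9, 51], [7, 10, 36], [7, 11, 12],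
     [7, 13, 33], [7, 14, 18], [7, 15, 54], [7, 21, 57], [7, 27, 45], [7, 30, 39], [8, 15, 42],
     [8, 18, 39], [8, 21, 36], [8, 24, 33], [8, 27, 30], [8, 45, 54], [8, 48, 51, 57],
     [9, 10, 11], [9, 12, 15, 27], [9, 13, 54], [9, 14, 30], [9, 33, 57], [9, 39, 45],
     [10, 12, 54], [10, 13, 30, 42], [10, 14, 15], [10, 18, 57], [10, 24, 45], [11, 14, 54, 57],
     [11, 21, 42], [11, 24, 39], [11, 27, 36], [11, 45, 51], [12, 13, 14], [12, 30, 57],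
     [12, 36, 45], [12, 42, 48], [13, 15, 57], [13, 21, 45], [13, 27, 48], [14, 27, 42],
     [14, 45, 48], [15, 33, 45], [15, 39, 48], [18, 21, 24, 27], [18, 30, 45], [18, 36, 48],
     [18, 42, 51], [21, 33, 48], [21, 39, 51], [24, 30, 48], [24, 36, 51], [24, 42, 54],
     [27, 33, 51], [27, 39, 54], [33, 36, 39, 42]])
    (by decide +kernel) hs

/-! ### The field of order four. -/

/-- The field with four elements: `2` and `3` are the primitive cube roots of unity. -/
def F4 : Type := Fin 4

namespace F4

instance : DecidableEq F4 := inferInstanceAs (DecidableEq (Fin 4))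
instance : Fintype F4 := inferInstanceAs (Fintype (Fin 4))

def ofFin (a : Fin 4) : F4 := a

/-- With explicit tables, the field axioms and the later checks in the affine plane can be settled
by evaluation. -/
def addTable : Fin 4 → Fin 4 → Fin 4 :=
  ![![0, 1, 2, 3], ![1, 0, 3, 2], ![2, 3, 0, 1], ![3, 2, 1, 0]]

def mulTable : Fin 4 → Fin 4 → Fin 4 :=
  ![![0, 0, 0, 0], ![0, 1, 2, 3], ![0, 2, 3, 1], ![0, 3, 1, 2]]

instance : Zero F4 := ⟨ofFin 0⟩
instance : One F4 := ⟨ofFin 1⟩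
instance : Add F4 := ⟨addTable⟩
instance : Mul F4 := ⟨mulTable⟩
instance : Neg F4 := ⟨id⟩
instance : Inv F4 := ⟨![ofFin 0, ofFin 1, ofFin 3, ofFin 2]⟩

instance : Field F4 where
  add_assoc := by decide
  zero_add := by decide
  add_zero := by decide
  add_comm := by decide
  neg_add_cancel := by decide
  mul_assoc := by decide
  one_mul := by decide
  mul_one := by decide
  zero_mul := by decide
  mul_zero := by decide
  left_distrib := by decide
  right_distrib := by decide
  mul_comm := by decide
  exists_pair_ne := ⟨0, 1, by decide⟩
  mul_inv_cancel := by decide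
  inv_zero := by decide
  nsmul := nsmulRec
  zsmul := zsmulRec
  nnqsmul := _
  qsmul := _

theorem card_eq : Fintype.card F4 = 4 := rfl

theorem natCard_eq : Nat.card F4 = 4 := by rw [Nat.card_eq_fintype_card, card_eq]

end F4

/-! ### Affine sets without three-secants. -/

/-- No line of the affine space meets `C` in exactly three points. -/
def NoThreeSecant {V : Type*} [AddCommGroup V] [Module F4 V] [DecidableEq V] (C : Finset V) :
    Prop :=
  ∀ x u : V, u ≠ 0 → (Finset.univ.filter fun t : F4 => x + t • u ∈ C).card ≠ 3

/-- The affine space `V` has a set of `c` points that meets no line in exactly three points. -/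
def HasNoThreeSecant (V : Type*) [AddCommGroup V] [Module F4 V] [DecidableEq V] (c : ℕ) : Prop :=
  ∃ C : Finset V, NoThreeSecant C ∧ C.card = c

theorem HasNoThreeSecant.of_linearEquiv {V W : Type*} [AddCommGroup V] [Module F4 V]
    [DecidableEq V] [AddCommGroup W] [Module F4 W] [DecidableEq W] (e : V ≃ₗ[F4] W) {c : ℕ}
    (h : HasNoThreeSecant V c) : HasNoThreeSecant W c := by
  obtain ⟨C, hC, rfl⟩ := h
  refine ⟨C.map e.toEquiv.toEmbedding, ?_, by simp⟩
  intro x u hu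
  have := hC (e.symm x) (e.symm u) (by simpa using hu)
  convert this using 4 with t
  rw [Finset.mem_map_equiv]
  change e.symm (x + t • u) ∈ C ↔ _
  rw [map_add, map_smul]

/-- Sets without three-secants are placed above the points of a cap, in parallel subspaces. -/
theorem hasNoThreeSecant_prod {V W ι : Type*} [AddCommGroup V] [Module F4 V] [DecidableEq V]
    [AddCommGroup W] [Module F4 W] [DecidableEq W] [Fintype ι] [DecidableEq ι] (φ : ι → V)
    (hφ : Function.Injective φ)
    (hcap : ∀ x u : V, u ≠ 0 →
      (Finset.univ.filter fun t : F4 => ∃ i, φ i = x + t • u).card ≤ 2)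
    (c : ι → ℕ) (hc : ∀ i, HasNoThreeSecant W (c i)) : HasNoThreeSecant (V × W) (∑ i, c i) := by
  choose C hC hcard using hc
  let emb : (Σ _ : ι, W) ↪ V × W :=
    ⟨fun p => (φ p.1, p.2), by
      rintro ⟨i, v⟩ ⟨j, w⟩ h
      simp only [Prod.mk.injEq] at h
      rw [hφ h.1, h.2]⟩
  have hmem : ∀ a v, (a, v) ∈ (Finset.univ.sigma C).map emb ↔ ∃ i, φ i = a ∧ v ∈ C i := by
    intro a v
    rw [Finset.mem_map]
    constructor
    · rintro ⟨⟨i, w⟩, hw, h⟩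
      obtain ⟨rfl, rfl⟩ := Prod.mk.inj h
      exact ⟨i, rfl, (Finset.mem_sigma.1 hw).2⟩
    · rintro ⟨i, rfl, hv⟩
      exact ⟨⟨i, v⟩, Finset.mem_sigma.2 ⟨Finset.mem_univ _, hv⟩, rfl⟩
  refine ⟨(Finset.univ.sigma C).map emb, ?_, by simp [hcard]⟩
  rintro ⟨x, y⟩ ⟨u, v⟩ huv
  have hline : ∀ t : F4, ((x, y) + t • (u, v) ∈ (Finset.univ.sigma C).map emb) ↔
      ∃ i, φ i = x + t • u ∧ y + t • v ∈ C i := fun t => by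
    rw [← hmem]; rfl
  simp only [hline]
  -- A line with `u = 0` stays in one fibre, where `C i` decides. Any other line projects
  -- injectively to a line of `V`, which meets the cap in at most two points.
  by_cases hu : u = 0
  · subst hu
    have hv : v ≠ 0 := fun h => huv (by rw [h]; rfl)
    by_cases hx : ∃ i, φ i = x
    · obtain ⟨i, rfl⟩ := hx
      convert hC i y v hv using 4 with t
      simp only [smul_zero, add_zero]
      constructor
      · rintro ⟨j, hj, h⟩
        rwa [← hφ hj]
      · exact fun h => ⟨i, rfl, h⟩
    · rw [Finset.filter_false_of_mem]
      · simp
      · rintro t - ⟨i, hi, -⟩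
        exact hx ⟨i, by simpa using hi⟩
  · have h1 := hcap x u hu
    have h2 : (Finset.univ.filter fun t : F4 => ∃ i, φ i = x + t • u ∧ y + t • v ∈ C i).card ≤
        (Finset.univ.filter fun t : F4 => ∃ i, φ i = x + t • u).card := by
      apply Finset.card_le_card
      intro t ht
      obtain ⟨i, hi, -⟩ := (Finset.mem_filter.1 ht).2
      exact Finset.mem_filter.2 ⟨Finset.mem_univ _, i, hi⟩
    omega

/-- Two parallel hyperplanes. -/
theorem HasNoThreeSecant.add {n a b : ℕ} (ha : HasNoThreeSecant (Fin n → F4) a)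
    (hb : HasNoThreeSecant (Fin n → F4) b) : HasNoThreeSecant (Fin (n + 1) → F4) (a + b) := by
  have := hasNoThreeSecant_prod (V := F4) (W := Fin n → F4) (![0, 1] : Fin 2 → F4) (by decide)
    (by decide) ![a, b] (by intro i; fin_cases i <;> assumption)
  rw [Fin.sum_univ_two] at this
  exact this.of_linearEquiv (LinearEquiv.ofFinrankEq _ _ (by simp [add_comm]))

/-- The points of an affine hyperoval. -/
def hyperoval : Fin 6 → F4 × F4 :=
  ![(F4.ofFin 0, F4.ofFin 0), (F4.ofFin 0, F4.ofFin 1), (F4.ofFin 1, F4.ofFin 0),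
    (F4.ofFin 1, F4.ofFin 2), (F4.ofFin 2, F4.ofFin 1), (F4.ofFin 2, F4.ofFin 2)]

/-- Subspaces of codimension two above the points of a hyperoval. -/
theorem hasNoThreeSecant_sum_six {n : ℕ} (c : Fin 6 → ℕ)
    (hc : ∀ i, HasNoThreeSecant (Fin n → F4) (c i)) :
    HasNoThreeSecant (Fin (n + 2) → F4) (∑ i, c i) := by
  have := hasNoThreeSecant_prod (V := F4 × F4) (W := Fin n → F4) hyperoval (by decide)
    (by decide +kernel) c hc
  exact this.of_linearEquiv (LinearEquiv.ofFinrankEq _ _ (by simp [add_comm]))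

theorem hasNoThreeSecant_zero (n : ℕ) : HasNoThreeSecant (Fin n → F4) 0 :=
  ⟨∅, fun _ _ _ => by simp, rfl⟩

theorem hasNoThreeSecant_univ (n : ℕ) : HasNoThreeSecant (Fin n → F4) (4 ^ n) :=
  ⟨Finset.univ, fun _ _ _ => by simp [F4.card_eq], by simp [F4.card_eq]⟩

theorem hasNoThreeSecant_two_of_le {c : ℕ} (hc : c ≤ 6) : HasNoThreeSecant (Fin 2 → F4) c := by
  have h0 := hasNoThreeSecant_zero 0
  have h1 := hasNoThreeSecant_univ 0
  have := hasNoThreeSecant_sum_six (n := 0) (fun i => if (i : ℕ) < c then 1 else 0)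
    (fun i => by split_ifs <;> assumption)
  convert this using 1
  interval_cases c <;> rfl

/-- The union of two lines. -/
theorem hasNoThreeSecant_two_seven : HasNoThreeSecant (Fin 2 → F4) 7 := by
  have : HasNoThreeSecant (F4 × F4) 7 :=
    ⟨Finset.univ.filter fun p => p.1 * p.2 = 0, by unfold NoThreeSecant; decide +kernel,
      by decide +kernel⟩
  exact this.of_linearEquiv (LinearEquiv.ofFinrankEq _ _ (by simp))

/-- Induction in steps of two dimensions, with `q = 4 ^ n`. Of the six fibres above a hyperoval,
each with `4 * q` points, up to three are filled, one is empty or holds two parallel subspaces of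
`q` points, and two hold sets of at most `q` points given by induction. The largest total is 12q +
2q + 2q = 16q, as needed. -/
theorem hasNoThreeSecant_of_le_pow : ∀ n c : ℕ, c ≤ 4 ^ n →
    HasNoThreeSecant (Fin (n + 1) → F4) c
  | 0, c, hc => by
    have : c = 0 ∨ c = 1 := by simp at hc; omega
    rcases this with rfl | rfl
    · exact hasNoThreeSecant_zero 1
    · exact (hasNoThreeSecant_zero 0).add (hasNoThreeSecant_univ 0)
  | 1, c, hc => hasNoThreeSecant_two_of_le (by omega)
  | n + 2, c, hc => by
    have ih := hasNoThreeSecant_of_le_pow n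
    set q := 4 ^ n with hq
    have hpos : 0 < q := by positivity
    have hfull : HasNoThreeSecant (Fin (n + 1) → F4) (4 * q) := by
      have := hasNoThreeSecant_univ (n + 1)
      rwa [pow_succ, mul_comm] at this
    have hhalf : HasNoThreeSecant (Fin (n + 1) → F4) (2 * q) := by
      rw [two_mul]
      exact (hasNoThreeSecant_univ n).add (hasNoThreeSecant_univ n)
    have h0 := hasNoThreeSecant_zero (n + 1)
    have hc' : c ≤ 16 * q := by rw [pow_add] at hc; omega
    obtain ⟨k, r, hk, hr, rfl⟩ : ∃ k r, k ≤ 3 ∧ r ≤ 4 * q ∧ c = k * (4 * q) + r := by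
      rcases le_total c (4 * q) with h | h
      · exact ⟨0, c, by omega, h, by omega⟩
      rcases le_total c (8 * q) with h | h
      · exact ⟨1, c - 4 * q, by omega, by omega, by omega⟩
      rcases le_total c (12 * q) with h | h
      · exact ⟨2, c - 8 * q, by omega, by omega, by omega⟩
      · exact ⟨3, c - 12 * q, by omega, by omega, by omega⟩
    obtain ⟨e, a, b, he, ha, hb, rfl⟩ : ∃ e a b, (e = 0 ∨ e = 2 * q) ∧ a ≤ q ∧ b ≤ q ∧
        r = e + a + b := by
      rcases le_total r (2 * q) with h | h
      · exact ⟨0, min r q, r - min r q, by omega, by omega, by omega, by omega⟩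
      · exact ⟨2 * q, min (r - 2 * q) q, r - 2 * q - min (r - 2 * q) q, by omega, by omega,
          by omega, by omega⟩
    have he' : HasNoThreeSecant (Fin (n + 1) → F4) e := by
      rcases he with rfl | rfl <;> assumption
    have hf : ∀ j : ℕ, HasNoThreeSecant (Fin (n + 1) → F4) (if j < k then 4 * q else 0) := by
      intro j; split_ifs <;> assumption
    have := hasNoThreeSecant_sum_six (n := n + 1)
      ![if 0 < k then 4 * q else 0, if 1 < k then 4 * q else 0, if 2 < k then 4 * q else 0,
        e, a, b]
      (by
        intro i
        fin_cases i
        · exact hf 0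
        · exact hf 1
        · exact hf 2
        · exact he'
        · exact ih a ha
        · exact ih b hb)
    convert this using 1
    rw [Fin.sum_univ_six]
    simp only [Matrix.cons_val]
    interval_cases k <;> simp <;> ring

theorem projCount_succ (q d : ℕ) : projCount q (d + 1) = projCount q d + q ^ (d + 1) :=
  Finset.sum_range_succ _ _

theorem projCount_succ' (q d : ℕ) : projCount q (d + 1) = q * projCount q d + 1 := by
  rw [projCount, Finset.sum_range_succ', projCount, Finset.mul_sum]
  simp [pow_succ']

/-- A set too large for `hasNoThreeSecant_of_le_pow` consists of a full hyperplane and a smaller set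
in a parallel one; the bound drops by exactly the size of the hyperplane. In the plane the bound is
7, reached by two intersecting lines. -/
theorem hasNoThreeSecant_of_le_projCount : ∀ n c : ℕ, c ≤ projCount 4 (n + 1) + 2 →
    HasNoThreeSecant (Fin (n + 2) → F4) c
  | 0, c, hc => by
    have h5 : projCount 4 1 = 5 := rfl
    rcases Nat.lt_or_ge c 7 with h | h
    · exact hasNoThreeSecant_two_of_le (by omega)
    · obtain rfl : c = 7 := by simp only [zero_add] at hc; omega
      exact hasNoThreeSecant_two_seven
  | n + 1, c, hc => by
    rcases le_total c (4 ^ (n + 2)) with h | h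
    · exact hasNoThreeSecant_of_le_pow _ _ h
    · have := (hasNoThreeSecant_univ (n + 2)).add
        (hasNoThreeSecant_of_le_projCount n (c - 4 ^ (n + 2)) (by
          have : projCount 4 (n + 1 + 1) = projCount 4 (n + 1) + 4 ^ (n + 2) := projCount_succ 4 (n + 1)
          omega))
      rwa [Nat.add_sub_cancel' h] at this

/-! ### Subspaces of projective space and weights on its points. -/

open scoped LinearAlgebra.Projectivization

section ProjectiveSpace

variable {V : Type} [AddCommGroup V] [Module F4 V] [Finite V]

noncomputable instance : Fintype (ℙ F4 V) := Fintype.ofFinite _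

noncomputable instance : DecidableEq (ℙ F4 V) := Classical.decEq _

open Classical in
/-- The points of the projective subspace defined by `W`. -/
noncomputable def projPoints (W : Submodule F4 V) : Finset (ℙ F4 V) :=
  Finset.univ.filter fun p => p.submodule ≤ W

theorem mem_projPoints {W : Submodule F4 V} {p : ℙ F4 V} :
    p ∈ projPoints W ↔ p.submodule ≤ W := by
  classical
  simp [projPoints]

theorem mk_mem_projPoints {W : Submodule F4 V} {v : V} (hv : v ≠ 0) :
    Projectivization.mk F4 v hv ∈ projPoints W ↔ v ∈ W := by
  rw [mem_projPoints, Projectivization.submodule_mk, Submodule.span_singleton_le_iff_mem]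

theorem projPoints_mono {W W' : Submodule F4 V} (h : W ≤ W') : projPoints W ⊆ projPoints W' :=
  fun _ hp => mem_projPoints.2 ((mem_projPoints.1 hp).trans h)

theorem projPoints_top : projPoints (⊤ : Submodule F4 V) = Finset.univ := by
  ext p
  simp [mem_projPoints]

theorem card_projPoints (W : Submodule F4 V) :
    (projPoints W).card = ∑ i ∈ Finset.range (Module.finrank F4 W), 4 ^ i := by
  have h := Projectivization.card_of_finrank F4 W rfl
  rw [F4.natCard_eq] at h
  have hinj := Projectivization.map_injective W.subtype W.injective_subtype
  rw [← h, Nat.card_eq_fintype_card, ← Finset.card_univ,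
    ← Finset.card_image_of_injective _ hinj]
  congr 1
  ext p
  simp only [mem_projPoints, Finset.mem_image, Finset.mem_univ, true_and]
  constructor
  · intro hp
    have hmem : p.rep ∈ W := by
      apply hp
      rw [Projectivization.submodule_eq]
      exact Submodule.mem_span_singleton_self _
    refine ⟨Projectivization.mk F4 ⟨p.rep, hmem⟩ fun h => p.rep_nonzero (congrArg Subtype.val h),
      ?_⟩
    rw [Projectivization.map_mk]
    exact p.mk_rep
  · rintro ⟨q, rfl⟩
    induction q using Projectivization.ind with
    | h v hv =>
      rw [Projectivization.map_mk, Projectivization.submodule_mk,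
        Submodule.span_singleton_le_iff_mem]
      exact v.2

theorem card_projPoints_le {W : Submodule F4 V} {k : ℕ} (h : Module.finrank F4 W ≤ k) :
    (projPoints W).card ≤ ∑ i ∈ Finset.range k, 4 ^ i := by
  rw [card_projPoints]
  exact Finset.sum_le_sum_of_subset (Finset.range_subset_range.2 h)

omit [Finite V] in
theorem finrank_sup_of_ne {p q : ℙ F4 V} (h : p ≠ q) :
    Module.finrank F4 ↥(p.submodule ⊔ q.submodule) = 2 := by
  have h1 := Submodule.finrank_sup_add_finrank_inf_eq p.submodule q.submodule
  rw [p.finrank_submodule, q.finrank_submodule] at h1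
  have h2 : Module.finrank F4 ↥(p.submodule ⊓ q.submodule) = 0 := by
    by_contra h0
    apply h
    apply Projectivization.submodule_injective
    have e1 : p.submodule ⊓ q.submodule = p.submodule :=
      Submodule.eq_of_le_of_finrank_le inf_le_left (by rw [p.finrank_submodule]; omega)
    have e2 : p.submodule ⊓ q.submodule = q.submodule :=
      Submodule.eq_of_le_of_finrank_le inf_le_right (by rw [q.finrank_submodule]; omega)
    rw [← e1, e2]
  omega

theorem sup_eq_of_mem {p q : ℙ F4 V} (h : p ≠ q) {W : Submodule F4 V}
    (hW : Module.finrank F4 W = 2) (hp : p ∈ projPoints W) (hq : q ∈ projPoints W) :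
    p.submodule ⊔ q.submodule = W :=
  Submodule.eq_of_le_of_finrank_le (sup_le (mem_projPoints.1 hp) (mem_projPoints.1 hq))
    (by rw [finrank_sup_of_ne h, hW])

theorem left_mem_projPoints_sup (p q : ℙ F4 V) : p ∈ projPoints (p.submodule ⊔ q.submodule) :=
  mem_projPoints.2 le_sup_left

theorem right_mem_projPoints_sup (p q : ℙ F4 V) : q ∈ projPoints (p.submodule ⊔ q.submodule) :=
  mem_projPoints.2 le_sup_right

theorem projPoints_subset_of_mem {a b : ℙ F4 V} (h : a ≠ b) {W T : Submodule F4 V}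
    (hW : Module.finrank F4 W = 2) (ha : a ∈ projPoints W) (hb : b ∈ projPoints W)
    (ha' : a ∈ projPoints T) (hb' : b ∈ projPoints T) : projPoints W ⊆ projPoints T := by
  rw [← sup_eq_of_mem h hW ha hb]
  exact projPoints_mono (sup_le (mem_projPoints.1 ha') (mem_projPoints.1 hb'))

omit [Finite V] in
theorem finrank_span_three_le (p q r : ℙ F4 V) :
    Module.finrank F4 ↥(p.submodule ⊔ q.submodule ⊔ r.submodule) ≤ 3 := by
  have h1 := Submodule.finrank_add_le_finrank_add_finrank p.submodule q.submodule
  have h2 := Submodule.finrank_add_le_finrank_add_finrank (p.submodule ⊔ q.submodule) r.submodule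
  rw [p.finrank_submodule, q.finrank_submodule] at h1
  rw [r.finrank_submodule] at h2
  omega

theorem exists_ne_point (hV : 2 ≤ Module.finrank F4 V) (p : ℙ F4 V) : ∃ q, p ≠ q := by
  by_contra! h
  have h1 := card_projPoints (⊤ : Submodule F4 V)
  have h2 : (projPoints (⊤ : Submodule F4 V)).card ≤ 1 :=
    Finset.card_le_one.2 fun a _ b _ => (h a).symm.trans (h b)
  rw [finrank_top] at h1
  have h3 : ∑ i ∈ Finset.range 2, 4 ^ i ≤ ∑ i ∈ Finset.range (Module.finrank F4 V), 4 ^ i :=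
    Finset.sum_le_sum_of_subset (Finset.range_subset_range.2 hV)
  have h4 : ∑ i ∈ Finset.range 2, 4 ^ i = 5 := rfl
  omega

theorem card_projPoints_line {W : Submodule F4 V} (hW : Module.finrank F4 W = 2) :
    (projPoints W).card = 5 := by
  rw [card_projPoints, hW]
  rfl

/-- Weights on the points of a projective space of order four for which every line has an
admissible type. -/
theorem exists_pbd_of_lineTypes (hV : 2 ≤ Module.finrank F4 V) (w : ℙ F4 V → ℕ)
    (hw3 : ∀ p, w p ≤ 3)
    (hw : ∀ W : Submodule F4 V, Module.finrank F4 W = 2 →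
      ∃ L ∈ lineTypes, (projPoints W).val.map w = (L : Multiset ℕ)) :
    ∃ (X : Type) (_ : Fintype X) (D : PBD X {3, 4, 5}), Fintype.card X = ∑ p, w p ∧
      ∀ S : Finset X, S.card = 3 → (D.flatSpan (S : Set X)).ncard ≤ 63 := by
  refine exists_pbd_of_weights w
    {l | ∃ W : Submodule F4 V, Module.finrank F4 W = 2 ∧ projPoints W = l} ?_ ?_ ?_ ?_ 63 ?_
  · intro p q h
    exact ⟨_, ⟨_, finrank_sup_of_ne h, rfl⟩, left_mem_projPoints_sup p q,
      right_mem_projPoints_sup p q⟩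
  · rintro p q h _ ⟨W, hW, rfl⟩ _ ⟨W', hW', rfl⟩ hp hq hp' hq'
    rw [← sup_eq_of_mem h hW hp hq, ← sup_eq_of_mem h hW' hp' hq']
  · intro p
    obtain ⟨q, h⟩ := exists_ne_point hV p
    exact ⟨_, ⟨_, finrank_sup_of_ne h, rfl⟩, left_mem_projPoints_sup p q⟩
  · rintro _ ⟨W, hW, rfl⟩
    obtain ⟨L, hL, h⟩ := hw W hW
    exact hasWeightedDesign_of_mem_lineTypes hL h
  · intro p q r
    -- The closed set is a plane containing the three points: at most 21 points of weight at most 3.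
    refine ⟨projPoints (p.submodule ⊔ q.submodule ⊔ r.submodule),
      mem_projPoints.2 (le_sup_left.trans le_sup_left),
      mem_projPoints.2 (le_sup_right.trans le_sup_left), mem_projPoints.2 le_sup_right, ?_, ?_⟩
    · have h1 := card_projPoints_le (finrank_span_three_le p q r)
      have h2 : ∑ i ∈ Finset.range 3, 4 ^ i = 21 := rfl
      refine (Finset.sum_le_card_nsmul _ _ 3 fun p _ => hw3 p).trans ?_
      rw [smul_eq_mul]
      omega
    · rintro _ ⟨W, hW, rfl⟩ a ha b hb hab haW hbW
      exact projPoints_subset_of_mem hab hW haW hbW ha hb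

end ProjectiveSpace

/-- With two possible weights, the type of a line depends only on how many of its points satisfy
`S`. -/
theorem map_ite_eq_replicate {P : Type*} (s : Finset P) (S : P → Prop) [DecidablePred S]
    (a b : ℕ) : s.val.map (fun p => if S p then a else b) =
      ((List.replicate (s.filter S).card a ++ List.replicate (s.card - (s.filter S).card) b :
        List ℕ) : Multiset ℕ) := by
  rw [← Multiset.coe_add, Multiset.coe_replicate, Multiset.coe_replicate]
  conv_lhs => rw [← Multiset.filter_add_not S s.val]
  rw [Multiset.map_add]
  congr 1
  · rw [Multiset.map_congr rfl (g := fun _ => a), Multiset.map_const']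
    · rfl
    · intro x hx
      rw [if_pos (Multiset.mem_filter.1 hx).2]
  · rw [Multiset.map_congr rfl (g := fun _ => b), Multiset.map_const']
    · congr 1
      have := Finset.card_filter_add_card_filter_not (s := s) S
      change (s.filter fun p => ¬ S p).card = _
      omega
    · intro x hx
      rw [if_neg (Multiset.mem_filter.1 hx).2]

theorem exists_lineType_of_one_or_three {P : Type*} {s : Finset P} (hs : s.card = 5) {w : P → ℕ}
    (hw : ∀ p ∈ s, w p = 1 ∨ w p = 3) :
    ∃ L ∈ lineTypes, s.val.map w = (L : Multiset ℕ) := by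
  have h := map_ite_eq_replicate s (fun p => w p = 3) 3 1
  have hle := Finset.card_filter_le s fun p => w p = 3
  rw [hs] at h hle
  refine ⟨_, ?_, (Multiset.map_congr rfl ?_).trans h⟩
  · generalize (s.filter fun p => w p = 3).card = k at *
    interval_cases k <;> decide
  · intro p hp
    rcases hw p hp with h | h <;> simp [h]

theorem exists_lineType_of_zero_one {P : Type*} {s : Finset P} (hs : s.card = 5) (S : P → Prop)
    [DecidablePred S] (hS : (s.filter S).card ≠ 3) :
    ∃ L ∈ lineTypes, s.val.map (fun p => if S p then 0 else 1) = (L : Multiset ℕ) := by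
  have h := map_ite_eq_replicate s (fun p => ¬ S p) 1 0
  have hle := Finset.card_filter_le s fun p => ¬ S p
  have hadd := Finset.card_filter_add_card_filter_not (s := s) S
  rw [hs] at h hle hadd
  refine ⟨_, ?_, (Multiset.map_congr rfl ?_).trans h⟩
  · generalize (s.filter fun p => ¬ S p).card = k at *
    have : k ≠ 2 := by omega
    interval_cases k <;> first | contradiction | decide
  · intro p _
    by_cases h : S p <;> simp [h]

/-! ### The four choices of weights. -/

/-- There is a PBD on `v` points in which three points generate a flat of at most `m` points. -/
def HasPBD (v m : ℕ) : Prop :=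
  ∃ (X : Type) (_ : Fintype X) (D : PBD X {3, 4, 5}), Fintype.card X = v ∧
    ∀ S : Finset X, S.card = 3 → (D.flatSpan (S : Set X)).ncard ≤ m

theorem HasPBD.of_le {v m k : ℕ} (h : HasPBD v k) (hv : v ≤ m) : HasPBD v m := by
  obtain ⟨X, hX, D, hc, -⟩ := h
  refine ⟨X, hX, D, hc, fun S _ => ?_⟩
  have := Set.ncard_le_card (D.flatSpan (S : Set X))
  rw [Nat.card_eq_fintype_card, hc] at this
  exact this.trans hv

/-- The splitting of the coordinate space singles out the affine points (1, x), the complement of a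
hyperplane. -/
theorem finrank_affineChart (d : ℕ) : Module.finrank F4 (F4 × (Fin d → F4)) = d + 1 := by
  simp [add_comm]

theorem card_projectiveSpace (d : ℕ) :
    (Finset.univ : Finset (ℙ F4 (F4 × (Fin d → F4)))).card = projCount 4 d := by
  rw [← projPoints_top, card_projPoints, finrank_top, finrank_affineChart, projCount]

/-- Weights one and three on the points of the whole projective space. -/
theorem hasPBD_of_odd {d v : ℕ} (hd : 1 ≤ d) (h1 : projCount 4 d ≤ v) (h2 : v ≤ 3 * projCount 4 d)
    (hpar : v % 2 = projCount 4 d % 2) : HasPBD v 63 := by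
  classical
  obtain ⟨S, -, hS⟩ := Finset.exists_subset_card_eq
    (s := (Finset.univ : Finset (ℙ F4 (F4 × (Fin d → F4)))))
    -- Each point of weight three raises the total by two.
    (n := (v - projCount 4 d) / 2) (by rw [card_projectiveSpace]; omega)
  have hsum : ∑ p, (if p ∈ S then 3 else 1) = v := by
    rw [Finset.sum_ite, Finset.sum_const, Finset.sum_const, Finset.filter_univ_mem, hS]
    have h3 := Finset.card_filter_add_card_filter_not
      (s := (Finset.univ : Finset (ℙ F4 (F4 × (Fin d → F4))))) (· ∈ S)
    rw [card_projectiveSpace, Finset.filter_univ_mem, hS] at h3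
    simp only [smul_eq_mul]
    omega
  have := exists_pbd_of_lineTypes (V := F4 × (Fin d → F4)) (by rw [finrank_affineChart]; omega)
    (fun p => if p ∈ S then 3 else 1) (fun p => by split_ifs <;> omega)
    (fun W hW => exists_lineType_of_one_or_three (card_projPoints_line hW)
      fun p _ => by split_ifs <;> simp)
  rwa [hsum] at this

section Truncation

variable {d : ℕ}

def affinePoint (x : Fin d → F4) : ℙ F4 (F4 × (Fin d → F4)) :=
  Projectivization.mk F4 (1, x) fun h => one_ne_zero (congrArg Prod.fst h)

theorem affinePoint_injective : Function.Injective (affinePoint (d := d)) := by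
  intro x y h
  obtain ⟨a, ha⟩ := (Projectivization.mk_eq_mk_iff' _ _ _ _ _).1 h
  simp only [Prod.smul_mk, Prod.mk.injEq, smul_eq_mul, mul_one] at ha
  rw [← ha.2, ha.1, one_smul]

/-- A combination of (1, x) and (1, y) has first coordinate 1 exactly when its coefficients sum to
1. -/
theorem affinePoint_mem_sup {x y z : Fin d → F4} :
    affinePoint z ∈ projPoints ((affinePoint x).submodule ⊔ (affinePoint y).submodule) ↔
      ∃ t : F4, x + t • (y - x) = z := by
  unfold affinePoint
  rw [mk_mem_projPoints, Projectivization.submodule_mk,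
    Projectivization.submodule_mk, Submodule.mem_sup]
  constructor
  · rintro ⟨_, h1, _, h2, h⟩
    obtain ⟨a, rfl⟩ := Submodule.mem_span_singleton.1 h1
    obtain ⟨b, rfl⟩ := Submodule.mem_span_singleton.1 h2
    simp only [Prod.smul_mk, Prod.mk_add_mk, Prod.mk.injEq, smul_eq_mul, mul_one] at h
    refine ⟨b, ?_⟩
    rw [← h.2, eq_sub_of_add_eq h.1]
    module
  · rintro ⟨t, rfl⟩
    refine ⟨_, Submodule.mem_span_singleton.2 ⟨1 - t, rfl⟩, _,
      Submodule.mem_span_singleton.2 ⟨t, rfl⟩, ?_⟩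
    simp only [Prod.smul_mk, Prod.mk_add_mk, Prod.mk.injEq, smul_eq_mul, mul_one]
    exact ⟨by ring, by module⟩

/-- Two deleted points on the line are affine and parametrise its affine part, so a third one would
turn it into an affine three-secant of `C` if there were no more. -/
theorem card_line_inter_affine_ne_three {C : Finset (Fin d → F4)} (hC : NoThreeSecant C)
    {W : Submodule F4 (F4 × (Fin d → F4))} (hW : Module.finrank F4 W = 2) :
    ((projPoints W).filter (· ∈ C.image affinePoint)).card ≠ 3 := by
  intro h3
  obtain ⟨a, ha, b, hb, hab⟩ := Finset.one_lt_card.1 (by rw [h3]; norm_num)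
  obtain ⟨haW, haC⟩ := Finset.mem_filter.1 ha
  obtain ⟨hbW, hbC⟩ := Finset.mem_filter.1 hb
  obtain ⟨x, hx, rfl⟩ := Finset.mem_image.1 haC
  obtain ⟨y, hy, rfl⟩ := Finset.mem_image.1 hbC
  have hxy : y - x ≠ 0 := fun h => hab (by rw [sub_eq_zero.1 h])
  apply hC x (y - x) hxy
  rw [← h3, ← sup_eq_of_mem hab hW haW hbW]
  refine Finset.card_bij (fun t _ => affinePoint (x + t • (y - x))) ?_ ?_ ?_
  · intro t ht
    exact Finset.mem_filter.2 ⟨affinePoint_mem_sup.2 ⟨t, rfl⟩,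
      Finset.mem_image_of_mem _ (Finset.mem_filter.1 ht).2⟩
  · intro t _ t' _ h
    exact smul_left_injective F4 hxy (add_left_cancel (affinePoint_injective h))
  · intro p hp
    obtain ⟨hpW, hpC⟩ := Finset.mem_filter.1 hp
    obtain ⟨z, hz, rfl⟩ := Finset.mem_image.1 hpC
    obtain ⟨t, rfl⟩ := affinePoint_mem_sup.1 hpW
    exact ⟨t, Finset.mem_filter.2 ⟨Finset.mem_univ _, hz⟩, rfl⟩

end Truncation

/-- Deleting an affine set without three-secants. -/
theorem hasPBD_of_noThreeSecant {d c v : ℕ} (hd : 1 ≤ d) (hc : HasNoThreeSecant (Fin d → F4) c)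
    (hv : v + c = projCount 4 d) : HasPBD v 63 := by
  classical
  obtain ⟨C, hC, rfl⟩ := hc
  have hsum : ∑ p, (if p ∈ C.image affinePoint then 0 else 1) = v := by
    rw [Finset.sum_ite, Finset.sum_const, Finset.sum_const, smul_zero, zero_add, smul_eq_mul,
      mul_one]
    have h3 := Finset.card_filter_add_card_filter_not
      (s := (Finset.univ : Finset (ℙ F4 (F4 × (Fin d → F4))))) (· ∈ C.image affinePoint)
    rw [card_projectiveSpace, Finset.filter_univ_mem,
      Finset.card_image_of_injective _ affinePoint_injective] at h3
    omega
  have := exists_pbd_of_lineTypes (V := F4 × (Fin d → F4)) (by rw [finrank_affineChart]; omega)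
    (fun p => if p ∈ C.image affinePoint then 0 else 1)
    (fun p => by split_ifs <;> omega)
    (fun W hW => exists_lineType_of_zero_one (card_projPoints_line hW) _
      (card_line_inter_affine_ne_three hC hW))
  rwa [hsum] at this

/-- One point is deleted; on the lines through it the other four points have weights `1, 1, 1, 1`
on `j` lines, `1, 3, 3, 3` on `i` lines and `3, 3, 3, 3` on the remaining ones. -/
theorem hasPBD_of_deleted_point {d i j n v : ℕ} (hd : 1 ≤ d) (hn : projCount 4 d = 4 * n + 1)
    (hij : i + j ≤ n) (hv : v + 8 * j + 2 * i = 12 * n) : HasPBD v 63 := by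
  classical
  obtain ⟨p₀⟩ : Nonempty (ℙ F4 (F4 × (Fin d → F4))) := ⟨affinePoint 0⟩
  -- The fibres of `r` on `E` are the lines through `p₀` with `p₀` removed; `Q` is this pencil of
  -- `n` lines, and the fibres partition `E` into sets of four points.
  let r : ℙ F4 (F4 × (Fin d → F4)) → Submodule F4 (F4 × (Fin d → F4)) :=
    fun p => p.submodule ⊔ p₀.submodule
  set E := Finset.univ.erase p₀ with hE
  let Q := E.image r
  have hEcard : E.card = 4 * n := by
    rw [hE, Finset.card_erase_of_mem (Finset.mem_univ _), card_projectiveSpace, hn]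
    omega
  have hmemE : ∀ p, p ∈ E ↔ p ≠ p₀ := fun p => by simp [hE]
  have hfib : ∀ W : Submodule F4 (F4 × (Fin d → F4)), Module.finrank F4 W = 2 →
      p₀ ∈ projPoints W → E.filter (fun p => r p = W) = (projPoints W).erase p₀ := by
    intro W hW h₀
    ext p
    rw [Finset.mem_filter, hmemE, Finset.mem_erase]
    refine and_congr_right fun hp => ⟨?_, fun h => sup_eq_of_mem hp hW h h₀⟩
    rintro rfl
    exact left_mem_projPoints_sup p p₀
  have hQ : ∀ W : Submodule F4 (F4 × (Fin d → F4)), W ∈ Q ↔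
      Module.finrank F4 W = 2 ∧ p₀ ∈ projPoints W := by
    intro W
    constructor
    · intro h
      obtain ⟨p, hp, rfl⟩ := Finset.mem_image.1 h
      exact ⟨finrank_sup_of_ne ((hmemE p).1 hp), right_mem_projPoints_sup p p₀⟩
    · rintro ⟨hW, h₀⟩
      have : 0 < ((projPoints W).erase p₀).card := by
        rw [Finset.card_erase_of_mem h₀, card_projPoints_line hW]
        norm_num
      obtain ⟨p, hp⟩ := Finset.card_pos.1 this
      rw [← hfib W hW h₀] at hp
      obtain ⟨hpE, rfl⟩ := Finset.mem_filter.1 hp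
      exact Finset.mem_image_of_mem r hpE
  have hfibcard : ∀ W ∈ Q, (E.filter fun p => r p = W).card = 4 := by
    intro W hWQ
    obtain ⟨hW, h₀⟩ := (hQ W).1 hWQ
    rw [hfib W hW h₀, Finset.card_erase_of_mem h₀, card_projPoints_line hW]
  have hQcard : Q.card = n := by
    have := Finset.card_eq_sum_card_image r E
    rw [Finset.sum_congr rfl hfibcard, Finset.sum_const, hEcard, smul_eq_mul] at this
    change 4 * n = Q.card * 4 at this
    omega
  obtain ⟨Q₁, hQ₁, hQ₁c⟩ := Finset.exists_subset_card_eq (s := Q) (n := j) (by omega)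
  obtain ⟨Q₂, hQ₂, hQ₂c⟩ := Finset.exists_subset_card_eq (s := Q \ Q₁) (n := i)
    (by rw [Finset.card_sdiff_of_subset hQ₁]; omega)
  have hsel : ∀ W ∈ Q, ∃ p, p ∈ E ∧ r p = W := fun W hW => Finset.mem_image.1 hW
  have : Inhabited (ℙ F4 (F4 × (Fin d → F4))) := ⟨p₀⟩
  choose! sel hselE hselr using hsel
  -- `S` marks the points of weight one: all four on a line of `Q₁`, only the selected one on a line
  -- of `Q₂`.
  obtain ⟨S, hS⟩ : ∃ S : Submodule F4 (F4 × (Fin d → F4)) → ℙ F4 (F4 × (Fin d → F4)) → Prop,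
    ∀ W p, S W p ↔ W ∈ Q₁ ∨ (W ∈ Q₂ ∧ p = sel W) := ⟨_, fun _ _ => Iff.rfl⟩
  let w : ℙ F4 (F4 × (Fin d → F4)) → ℕ := fun p => if p = p₀ then 0 else if S (r p) p then 1 else 3
  let k : Submodule F4 (F4 × (Fin d → F4)) → ℕ :=
    fun W => (if W ∈ Q₁ then 4 else 0) + (if W ∈ Q₂ then 1 else 0)
  have hdisj : ∀ W, W ∈ Q₂ → W ∉ Q₁ := fun W h => (Finset.mem_sdiff.1 (hQ₂ h)).2
  have hk : ∀ W ∈ Q, ((E.filter fun p => r p = W).filter fun p => S W p).card = k W := by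
    intro W hW
    by_cases h1 : W ∈ Q₁
    · have h2 : W ∉ Q₂ := fun h => hdisj W h h1
      rw [Finset.filter_true_of_mem fun p _ => (hS W p).2 (Or.inl h1), hfibcard W hW]
      simp [k, h1, h2]
    · by_cases h2 : W ∈ Q₂
      · rw [Finset.card_eq_one.2 ⟨sel W, ?_⟩]
        · simp [k, h1, h2]
        · ext p
          simp only [Finset.mem_filter, hS, h1, h2, false_or, true_and, Finset.mem_singleton,
            and_iff_right_iff_imp]
          rintro rfl
          exact ⟨hselE W hW, hselr W hW⟩
      · rw [Finset.filter_false_of_mem fun p _ => by simp [hS, h1, h2]]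
        simp [k, h1, h2]
  have hwfib : ∀ W, ∀ p ∈ E.filter (fun p => r p = W), w p = if S W p then 1 else 3 := by
    intro W p hp
    obtain ⟨hpE, rfl⟩ := Finset.mem_filter.1 hp
    simp only [w, if_neg ((hmemE p).1 hpE)]
  -- Four points of weight three give 12, and each point of weight one lowers this by two.
  have hsumfib : ∀ W ∈ Q, ∑ p ∈ E.filter (fun p => r p = W), w p + 2 * k W = 12 := by
    intro W hW
    have h2 := Finset.card_filter_add_card_filter_not (s := E.filter fun p => r p = W) (fun p => S W p)
    rw [← hk W hW, Finset.sum_congr rfl (hwfib W), Finset.sum_ite, Finset.sum_const, Finset.sum_const]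
    rw [hfibcard W hW] at h2
    simp only [smul_eq_mul]
    omega
  have hsumk : ∑ W ∈ Q, k W = 4 * j + i := by
    have h2 : Q₂ ⊆ Q := hQ₂.trans Finset.sdiff_subset
    simp only [k, Finset.sum_add_distrib, ← Finset.sum_filter, Finset.filter_mem_eq_inter,
      Finset.inter_eq_right.2 hQ₁, Finset.inter_eq_right.2 h2, Finset.sum_const, hQ₁c, hQ₂c,
      smul_eq_mul]
    omega
  have hsum : ∑ p, w p = v := by
    have h1 : ∑ p, w p = ∑ p ∈ E, w p := by
      rw [hE, ← Finset.add_sum_erase _ _ (Finset.mem_univ p₀)]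
      simp [w]
    have h2 := Finset.sum_fiberwise_of_maps_to (s := E) (t := Q) (g := r)
      (fun p hp => Finset.mem_image_of_mem r hp) w
    have h3 := Finset.sum_congr (rfl : Q = Q) hsumfib
    rw [Finset.sum_add_distrib, ← Finset.mul_sum, hsumk, h2, Finset.sum_const, hQcard,
      smul_eq_mul] at h3
    omega
  have := exists_pbd_of_lineTypes (V := F4 × (Fin d → F4)) (by rw [finrank_affineChart]; omega) w
    (fun p => by simp only [w]; split_ifs <;> omega) ?_
  · rwa [hsum] at this
  · intro W hW
    by_cases h₀ : p₀ ∈ projPoints W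
    · have hWQ := (hQ W).2 ⟨hW, h₀⟩
      have h1 := map_ite_eq_replicate (E.filter fun p => r p = W) (fun p => S W p) 1 3
      rw [hk W hWQ, hfibcard W hWQ] at h1
      have h2 : (projPoints W).val.map w =
          0 ::ₘ ((E.filter fun p => r p = W).val.map fun p => if S W p then 1 else 3) := by
        rw [← Multiset.map_congr rfl (hwfib W), hfib W hW h₀, Finset.erase_val]
        conv_lhs => rw [← Multiset.cons_erase (show p₀ ∈ (projPoints W).val from h₀), Multiset.map_cons]
        simp [w]
      rw [h2, h1]
      have h3 : k W = 0 ∨ k W = 1 ∨ k W = 4 := by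
        have := hdisj W
        simp only [k]
        split_ifs <;> simp_all
      rcases h3 with h | h | h <;> rw [h]
      · exact ⟨[3, 3, 3, 3, 0], by decide, by decide⟩
      · exact ⟨[3, 3, 3, 1, 0], by decide, by decide⟩
      · exact ⟨[1, 1, 1, 1, 0], by decide, by decide⟩
    · refine exists_lineType_of_one_or_three (card_projPoints_line hW) fun p hp => ?_
      have : p ≠ p₀ := fun h => h₀ (h ▸ hp)
      simp only [w, if_neg this]
      split_ifs <;> simp

/-- One point is deleted, `t` points of a plane through it have weight three, and the points above
this plane carry a design of their own. -/
theorem hasPBD_of_plane {d t : ℕ} (hd : 2 ≤ d) (ht : t = 1 ∨ t = 2 ∨ t = 5) :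
    HasPBD (projCount 4 d - 1 + 2 * t) 94 := by
  classical
  obtain ⟨M, hM⟩ : ∃ M : Submodule F4 (F4 × (Fin d → F4)), Module.finrank F4 M = 3 := by
    let b := Module.finBasisOfFinrankEq F4 (F4 × (Fin d → F4)) (finrank_affineChart d)
    refine ⟨Submodule.span F4 (Set.range (b ∘ Fin.castLE (by omega : 3 ≤ d + 1))), ?_⟩
    rw [finrank_span_eq_card (b.linearIndependent.comp _ (Fin.castLE_injective _)),
      Fintype.card_fin]
  have hMcard : (projPoints M).card = 21 := by rw [card_projPoints, hM]; rfl
  obtain ⟨p₀, hp₀⟩ := Finset.card_pos.1 (by rw [hMcard]; norm_num : 0 < (projPoints M).card)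
  have hM' : ((projPoints M).erase p₀).card = 20 := by
    rw [Finset.card_erase_of_mem hp₀, hMcard]
  obtain ⟨S, hS, hSc⟩ := Finset.exists_subset_card_eq (s := (projPoints M).erase p₀) (n := t)
    (by omega)
  let w : ℙ F4 (F4 × (Fin d → F4)) → ℕ := fun p => if p = p₀ then 0 else if p ∈ S then 3 else 1
  have hw0 : w p₀ = 0 := if_pos rfl
  have hw13 : ∀ p, p ≠ p₀ → w p = 1 ∨ w p = 3 := by
    intro p hp
    simp only [w, if_neg hp]
    split_ifs <;> simp
  have hw3 : ∀ p, w p ≤ 3 := fun p => by simp only [w]; split_ifs <;> omega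
  have hsum : ∀ T, projPoints M ⊆ T → ∑ p ∈ T, w p = T.card - 1 + 2 * t := by
    intro T hT
    have h1 : S ⊆ T.erase p₀ := hS.trans (Finset.erase_subset_erase _ hT)
    have h2 := Finset.card_le_card h1
    have h3 := Finset.card_filter_add_card_filter_not (s := T.erase p₀) (· ∈ S)
    rw [Finset.filter_mem_eq_inter, Finset.inter_eq_right.2 h1, hSc,
      Finset.card_erase_of_mem (hT hp₀)] at h3
    rw [← Finset.add_sum_erase _ _ (hT hp₀), hw0, Finset.sum_congr rfl
      fun p hp => (if_neg (Finset.ne_of_mem_erase hp) : w p = if p ∈ S then 3 else 1),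
      Finset.sum_ite, Finset.sum_const, Finset.sum_const, Finset.filter_mem_eq_inter,
      Finset.inter_eq_right.2 h1, hSc]
    simp only [smul_eq_mul]
    omega
  have hmap : ∀ s : Finset (ℙ F4 (F4 × (Fin d → F4))), p₀ ∈ s → s.val.map w = 0 ::ₘ
      ((List.replicate ((s.erase p₀).filter (· ∈ S)).card 3 ++ List.replicate
        (s.card - 1 - ((s.erase p₀).filter (· ∈ S)).card) 1 : List ℕ) : Multiset ℕ) := by
    intro s hs
    rw [← Finset.card_erase_of_mem hs, ← map_ite_eq_replicate, Finset.erase_val]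
    conv_lhs => rw [← Multiset.cons_erase (show p₀ ∈ s.val from hs), Multiset.map_cons, hw0]
    rw [Multiset.map_congr rfl]
    intro p hp
    rw [← Finset.erase_val, Finset.mem_val] at hp
    exact if_neg (Finset.ne_of_mem_erase hp)
  have hplane : HasWeightedDesign w (projPoints M) := by
    have h := hmap _ hp₀
    rw [Finset.filter_mem_eq_inter, Finset.inter_eq_right.2 hS, hSc, hMcard] at h
    rcases ht with rfl | rfl | rfl
    · exact hasWeightedDesign_plane_22 (h.trans (by decide))
    · exact hasWeightedDesign_plane_24 (h.trans (by decide))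
    · exact hasWeightedDesign_plane_30 (h.trans (by decide))
  -- The lines inside the plane `M` are replaced by `M` itself as one large line. Through `p₀` they
  -- could have inadmissible types such as one 3, three 1s and a 0.
  have := exists_pbd_of_weights w ({projPoints M} ∪ {l | ∃ W : Submodule F4 (F4 × (Fin d → F4)),
    Module.finrank F4 W = 2 ∧ ¬ W ≤ M ∧ projPoints W = l}) ?_ ?_ ?_ ?_ 94 ?_
  · rwa [hsum _ (Finset.subset_univ _), card_projectiveSpace] at this
  · intro p q h
    by_cases hpq : p.submodule ⊔ q.submodule ≤ M
    · exact ⟨_, Or.inl rfl, mem_projPoints.2 (le_sup_left.trans hpq),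
        mem_projPoints.2 (le_sup_right.trans hpq)⟩
    · exact ⟨_, Or.inr ⟨_, finrank_sup_of_ne h, hpq, rfl⟩, left_mem_projPoints_sup p q,
        right_mem_projPoints_sup p q⟩
  · have hne : ∀ p q, p ≠ q → ∀ W : Submodule F4 (F4 × (Fin d → F4)), Module.finrank F4 W = 2 →
        ¬ W ≤ M → p ∈ projPoints W → q ∈ projPoints W → p ∈ projPoints M → q ∈ projPoints M →
        False := by
      intro p q h W hW hWM hp hq hp' hq'
      apply hWM
      rw [← sup_eq_of_mem h hW hp hq]
      exact sup_le (mem_projPoints.1 hp') (mem_projPoints.1 hq')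
    rintro p q h _ (rfl | ⟨W, hW, hWM, rfl⟩) _ (rfl | ⟨W', hW', hWM', rfl⟩) hp hq hp' hq'
    · rfl
    · exact (hne p q h W' hW' hWM' hp' hq' hp hq).elim
    · exact (hne p q h W hW hWM hp hq hp' hq').elim
    · rw [← sup_eq_of_mem h hW hp hq, ← sup_eq_of_mem h hW' hp' hq']
  · intro p
    obtain ⟨q, h⟩ := exists_ne_point (by rw [finrank_affineChart]; omega) p
    by_cases hpq : p.submodule ⊔ q.submodule ≤ M
    · exact ⟨_, Or.inl rfl, mem_projPoints.2 (le_sup_left.trans hpq)⟩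
    · exact ⟨_, Or.inr ⟨_, finrank_sup_of_ne h, hpq, rfl⟩, left_mem_projPoints_sup p q⟩
  · rintro _ (rfl | ⟨W, hW, hWM, rfl⟩)
    · exact hplane
    -- A line through `p₀` outside `M` meets `M` only in `p₀`, so its other points have weight one.
    · by_cases h₀ : p₀ ∈ projPoints W
      · refine hasWeightedDesign_of_mem_lineTypes (L := [1, 1, 1, 1, 0]) (by decide) ?_
        rw [hmap _ h₀, Finset.filter_false_of_mem, card_projPoints_line hW,
          Finset.card_empty]
        · decide
        · intro p hp hpS
          obtain ⟨hpne, hpW⟩ := Finset.mem_erase.1 hp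
          apply hWM
          rw [← sup_eq_of_mem hpne hW hpW h₀]
          exact sup_le (mem_projPoints.1 (Finset.mem_of_mem_erase (hS hpS)))
            (mem_projPoints.1 hp₀)
      · obtain ⟨L, hL, h⟩ := exists_lineType_of_one_or_three (card_projPoints_line hW)
          (w := w) fun p hp => hw13 p fun h => h₀ (h ▸ hp)
        exact hasWeightedDesign_of_mem_lineTypes hL h
  · intro p q r
    set T₀ := p.submodule ⊔ q.submodule ⊔ r.submodule with hT₀
    have hp : p.submodule ≤ T₀ := le_sup_left.trans le_sup_left
    have hq : q.submodule ≤ T₀ := le_sup_right.trans le_sup_left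
    have hr : r.submodule ≤ T₀ := le_sup_right
    have h3 : Module.finrank F4 T₀ ≤ 3 := finrank_span_three_le p q r
    -- If the span of the three points shares a line with `M`, a closed set must absorb `M`; the
    -- join has rank at most 4, so weight at most 84 + 2 * 5. Otherwise the span has at most one
    -- point in `M` and is itself closed.
    by_cases hint : 2 ≤ Module.finrank F4 ↥(T₀ ⊓ M)
    · refine ⟨projPoints (T₀ ⊔ M), mem_projPoints.2 (hp.trans le_sup_left),
        mem_projPoints.2 (hq.trans le_sup_left), mem_projPoints.2 (hr.trans le_sup_left), ?_, ?_⟩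
      · have h1 := Submodule.finrank_sup_add_finrank_inf_eq T₀ M
        have h2 := card_projPoints_le (W := T₀ ⊔ M) (k := 4) (by omega)
        have h4 : ∑ i ∈ Finset.range 4, 4 ^ i = 85 := rfl
        rw [hsum _ (projPoints_mono le_sup_right)]
        omega
      · rintro _ (rfl | ⟨W, hW, hWM, rfl⟩) a ha b hb hab haW hbW
        · exact projPoints_mono le_sup_right
        · exact projPoints_subset_of_mem hab hW haW hbW ha hb
    · refine ⟨projPoints T₀, mem_projPoints.2 hp, mem_projPoints.2 hq, mem_projPoints.2 hr, ?_, ?_⟩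
      · have h1 := card_projPoints_le h3
        have h2 : ∑ i ∈ Finset.range 3, 4 ^ i = 21 := rfl
        refine (Finset.sum_le_card_nsmul _ _ 3 fun p _ => hw3 p).trans ?_
        rw [smul_eq_mul]
        omega
      · rintro _ (rfl | ⟨W, hW, hWM, rfl⟩) a ha b hb hab haW hbW
        · exfalso
          apply hint
          rw [← finrank_sup_of_ne hab]
          exact Submodule.finrank_mono (le_inf
            (sup_le (mem_projPoints.1 ha) (mem_projPoints.1 hb))
            (sup_le (mem_projPoints.1 haW) (mem_projPoints.1 hbW)))
        · exact projPoints_subset_of_mem hab hW haW hbW ha hb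

/-! ### Arithmetic of v and assembly of the cases. -/

theorem projCount_four_mod_two (d : ℕ) : projCount 4 d % 2 = 1 := by
  cases d with
  | zero => rfl
  | succ d => rw [projCount_succ']; omega

/-- The ranges [d] - 1 ≤ v < 4[d] are consecutive because 4[d] = [d+1] - 1. -/
theorem exists_projCount_le (v : ℕ) (hv : 4 ≤ v) :
    ∃ d, 1 ≤ d ∧ projCount 4 d ≤ v + 1 ∧ v < 4 * projCount 4 d := by
  induction v, hv using Nat.le_induction with
  | base => exact ⟨1, le_rfl, by decide, by decide⟩
  | succ v hv ih =>
    obtain ⟨d, hd, h1, h2⟩ := ih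
    by_cases h : v + 1 < 4 * projCount 4 d
    · exact ⟨d, hd, by omega, h⟩
    · have := projCount_succ' 4 d
      exact ⟨d + 1, by omega, by omega, by omega⟩

/-- Even weights in the range covered by projective dimension `d`. -/
theorem hasPBD_of_even {d v : ℕ} (hd : 1 ≤ d) (h1 : projCount 4 d ≤ v + 1)
    (h2 : v + 3 ≤ 3 * projCount 4 d) (hpar : v % 2 = 0) (e1 : v ≠ projCount 4 d + 1)
    (e3 : v ≠ projCount 4 d + 3) (e9 : v ≠ projCount 4 d + 9) : HasPBD v 63 := by
  obtain ⟨d, rfl⟩ : ∃ d', d = d' + 1 := ⟨d - 1, by omega⟩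
  have hn := projCount_succ' 4 d
  generalize projCount 4 d = n at hn
  -- Now [d] = 4n + 1, and m = 4j + i points must have weight one. With i and j the remainder and
  -- quotient of m by 4, i + j ≤ n fails for m ≤ 4n only at m = 4n - 1, 4n - 2, 4n - 5, that is v =
  -- [d] + 1, [d] + 3, [d] + 9.
  obtain ⟨m, hm⟩ : ∃ m, v + 2 * m = 12 * n := ⟨(12 * n - v) / 2, by omega⟩
  exact hasPBD_of_deleted_point hd hn (i := m % 4) (j := m / 4) (by omega) (by omega)

/-- Apart from the exceptional values, three points generate a flat of at most `63` points. -/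
theorem hasPBD_sixtyThree {v : ℕ} (hv : 0 < v) (hv2 : v ≠ 2) (hv6 : v ≠ 6) (hv8 : v ≠ 8)
    (h : ∀ e, 3 ≤ e → v ≠ projCount 4 e + 1 ∧ v ≠ projCount 4 e + 3 ∧ v ≠ projCount 4 e + 9) :
    HasPBD v 63 := by
  have hp0 : projCount 4 0 = 1 := rfl
  have hp1 : projCount 4 1 = 5 := rfl
  have hp2 : projCount 4 2 = 21 := rfl
  rcases Nat.lt_or_ge v 4 with hlt | hge
  · obtain rfl | rfl : v = 1 ∨ v = 3 := by omega
    · exact hasPBD_of_noThreeSecant le_rfl (hasNoThreeSecant_univ 1) rfl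
    · exact hasPBD_of_noThreeSecant le_rfl
        ((hasNoThreeSecant_univ 0).add (hasNoThreeSecant_univ 0)) rfl
  obtain ⟨d, hd, h1, h2⟩ := exists_projCount_le v hge
  -- The number of points to delete from the next space is then at most [d] + 2, the bound for sets
  -- without three-secants.
  by_cases htrunc : 3 * projCount 4 d ≤ v + 1 ∧ v ≠ 3 * projCount 4 d
  · obtain ⟨d, rfl⟩ : ∃ d', d = d' + 1 := ⟨d - 1, by omega⟩
    have hs : projCount 4 (d + 2) = 4 * projCount 4 (d + 1) + 1 := projCount_succ' 4 (d + 1)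
    exact hasPBD_of_noThreeSecant (c := projCount 4 (d + 2) - v) (by omega)
      (hasNoThreeSecant_of_le_projCount d _ (by omega)) (by omega)
  have hodd := projCount_four_mod_two d
  rcases Nat.mod_two_eq_zero_or_one v with hv0 | hv1
  swap
  · exact hasPBD_of_odd hd (by omega) (by omega) (by omega)
  by_cases he : v = projCount 4 d + 1 ∨ v = projCount 4 d + 3 ∨ v = projCount 4 d + 9
  · obtain rfl | rfl | hd3 : d = 1 ∨ d = 2 ∨ 3 ≤ d := by omega
    -- For d = 1 the values are 6 and 8, which are excluded, and 14 = 3[1] - 1, already obtained by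
    -- deletion.
    · omega
    · rw [hp2] at he
      rcases he with rfl | rfl | rfl
      -- For d = 2 the values are 22, 24 and 30, so the bound 63 is trivial.
      · exact (hasPBD_of_plane (d := 2) le_rfl (Or.inl rfl)).of_le (by rw [hp2]; norm_num)
      · exact (hasPBD_of_plane (d := 2) le_rfl (Or.inr (Or.inl rfl))).of_le (by rw [hp2]; norm_num)
      · exact (hasPBD_of_plane (d := 2) le_rfl (Or.inr (Or.inr rfl))).of_le (by rw [hp2]; norm_num)
    · obtain ⟨ha, hb, hc⟩ := h d hd3
      omega
  · exact hasPBD_of_even hd h1 (by omega) hv0 (by omega) (by omega) (by omega)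

theorem hasPBD_ninetyFour {v e : ℕ} (he : 3 ≤ e)
    (h : v = projCount 4 e + 1 ∨ v = projCount 4 e + 3 ∨ v = projCount 4 e + 9) :
    HasPBD v 94 := by
  have h1 := projCount_four_mod_two e
  have he2 : 2 ≤ e := by omega
  rcases h with rfl | rfl | rfl
  · convert hasPBD_of_plane he2 (Or.inl rfl) using 1; omega
  · convert hasPBD_of_plane he2 (Or.inr (Or.inl rfl)) using 1; omega
  · convert hasPBD_of_plane he2 (Or.inr (Or.inr rfl)) using 1; omega

theorem mainTheorem2 (v : ℕ) (hv : 0 < v) (hv2 : v ≠ 2) (hv6 : v ≠ 6) (hv8 : v ≠ 8) :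
    ∃ (X : Type) (_ : Fintype X) (D : PBD X {3, 4, 5}), Fintype.card X = v ∧
      ((¬ ∃ e : ℕ, 3 ≤ e ∧ (v : ℤ) - (projCount 4 e : ℤ) ∈ ({1, 3, 9} : Set ℤ)) →
        ∀ S : Finset X, S.card = 3 → (D.flatSpan (S : Set X)).ncard ≤ 63) ∧
      ((∃ e : ℕ, 3 ≤ e ∧ (v : ℤ) - (projCount 4 e : ℤ) ∈ ({1, 3, 9} : Set ℤ)) →
        ∀ S : Finset X, S.card = 3 → (D.flatSpan (S : Set X)).ncard ≤ 94) := by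
  by_cases h : ∃ e : ℕ, 3 ≤ e ∧ (v : ℤ) - (projCount 4 e : ℤ) ∈ ({1, 3, 9} : Set ℤ)
  · obtain ⟨e, he, hve⟩ := h
    simp only [Set.mem_insert_iff, Set.mem_singleton_iff] at hve
    obtain ⟨X, hX, D, hc, hD⟩ := hasPBD_ninetyFour (v := v) he (by omega)
    exact ⟨X, hX, D, hc, fun hn => (hn ⟨e, he, by simpa using hve⟩).elim, fun _ => hD⟩
  · obtain ⟨X, hX, D, hc, hD⟩ := hasPBD_sixtyThree hv hv2 hv6 hv8 fun e he => by
      have : ¬ ((v : ℤ) - (projCount 4 e : ℤ) ∈ ({1, 3, 9} : Set ℤ)) := fun hm => h ⟨e, he, hm⟩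
      simp only [Set.mem_insert_iff, Set.mem_singleton_iff] at this
      omega
    exact ⟨X, hX, D, hc, fun _ => hD, fun hn => (h hn).elim⟩
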